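/- Let $\mathcal R=(\Lambda,S,\Lambda^\vee,S^\vee)$ be a based root datum, i.e. $(\Lambda,\Phi,\Lambda^\vee,\Phi^\vee)$ is a finite (reduced) root datum with Weyl group $W$ and $S\subseteq\Phi$ is a set of simple roots. Write $\langle\cdot\mid\cdot\rangle$ for the pairing and let $(\cdot,\cdot)$ be any $W$-invariant scalar product on $\Lambda\otimes\mathbb R$. A *weak spherical system* with respect to $\mathcal R$ is a triple $(\Xi,\Sigma,S^p)$ where $\Xi\subseteq\Lambda$ is a subgroup and $\Sigma\subseteq\Xi$, $S^p\subseteq S$ are subsets such that: 1. For every $\sigma\in\Sigma$ there is a subset $|\sigma|\subseteq S$ with $\sigma=\sum_{\alpha\in|\sigma|}n_\alpha\alpha$, all $n_\alpha\ge1$, such that $(|\sigma|,(n_\alpha),|\sigma|\cap S^p)$ is, up to isomorphism of Dynkin diagrams, one of the following (Bourbaki numbering, with $\alpha_n$ short in $\mathsf B_n$ and long in $\mathsf C_n$): - $\mathsf A_1$: $\sigma=\alpha_1$, $|\sigma|\cap S^p=\varnothing$; - $\mathsf A_n$, $n\ge2$: $\sigma=\alpha_1+\dots+\alpha_n$, $|\sigma|\cap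 S^p=|\sigma|\setminus\{\alpha_1,\alpha_n\}$; - $\mathsf B_n$, $n\ge2$: $\sigma=\alpha_1+\dots+\alpha_n$, $|\sigma|\cap S^p=|\sigma|\setminus\{\alpha_1\}$ or $|\sigma|\setminus\{\alpha_1,\alpha_n\}$; - $\mathsf C_n$, $n\ge3$: $\sigma=\alpha_1+2\alpha_2+\dots+2\alpha_{n-1}+\alpha_n$, $|\sigma|\cap S^p=|\sigma|\setminus\{\alpha_2\}$ or $|\sigma|\setminus\{\alpha_1,\alpha_2\}$; - $\mathsf F_4$ ($\alpha_3,\alpha_4$ short): $\sigma=\alpha_1+2\alpha_2+3\alpha_3+2\alpha_4$, $|\sigma|\cap S^p=\{\alpha_1,\alpha_2,\alpha_3\}$; - $\mathsf G_2$ ($\alpha_s$ short, $\alpha_l$ long): $\sigma=2\alpha_s+\alpha_l$, $|\sigma|\cap S^p=\{\alpha_l\}$; or $\sigma=\alpha_s+\alpha_l$, $|\sigma|\cap S^p=\varnothing$; - $\mathsf D_2$ (two orthogonal simple roots): $\sigma=\alpha_1+\alpha_2$, $|\sigma|\cap S^p=\varnothing$; - $\mathsf D_n$, $n\ge3$: $\sigma=2\alpha_1+\dots+2\alpha_{n-2}+\alpha_{n-1}+\alpha_n$,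 $|\sigma|\cap S^p=|\sigma|\setminus\{\alpha_1\}$ (where $\mathsf D_3$ is $\mathsf A_3$ with middle vertex $\alpha_1$); - $\mathsf B_3$: $\sigma=\alpha_1+2\alpha_2+3\alpha_3$, $|\sigma|\cap S^p=\{\alpha_1,\alpha_2\}$. 2. $\langle\chi\mid\alpha^\vee\rangle=0$ for all $\alpha\in S^p$ and $\chi\in\Xi$. 3. If $\alpha,\beta\in S$ are orthogonal and $\alpha+\beta\in\Sigma$, then $\langle\chi\mid\alpha^\vee-\beta^\vee\rangle=0$ for all $\chi\in\Xi$. 4. If $\alpha,\beta\in S$ and $\alpha,\alpha+\beta\in\Sigma$, then $\langle\beta\mid\alpha^\vee\rangle\ne-1$. **Theorem.** Let $(\Xi,\Sigma,S^p)$ be a weak spherical system with respect to $\mathcal R$, and put $\Xi^\vee=\operatorname{Hom}(\Xi,\mathbb Z)$. For every $\sigma\in\Sigma$ the map $\sigma^\vee:\chi\mapsto 2(\chi,\sigma)/(\sigma,\sigma)$ on $\Xi$ is integer-valued and does not depend on the choice of $(\cdot,\cdot)$, so $\sigma^\vee\in\Xi^\vee$. With $\Sigma^\vee=\{\sigma^\vee\mid\sigma\in\Sigma\}$,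 the quadruple $(\Xi,\Sigma,\Xi^\vee,\Sigma^\vee)$ is a based root datum: there is a finite reduced root datum on $\Xi$ and $\Xi^\vee$ (with the canonical pairing) for which $\Sigma$ is a set of simple roots and $\sigma^\vee$ is the coroot of $\sigma$ for every $\sigma\in\Sigma$. -/

import Mathlib

open scoped TensorProduct

universe u v w

/-- The table of weak spherical roots. `IsWeakSphericalDiagram C label black` says that the Dynkin
diagram with Cartan matrix `C` (where `C i j = ⟨α_i, α_j^∨⟩`, nodes numbered from `0`), with the
coefficients `label` of `σ` and with the set `black` of vertices lying in `S^p`, is a row of the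
table. The vertices outside `black` are the white ones. -/
inductive IsWeakSphericalDiagram :
    {n : ℕ} → Matrix (Fin n) (Fin n) ℤ → (Fin n → ℕ) → Set (Fin n) → Prop
  /-- `A₁`, `σ = α₁`, the vertex is white. -/
  | A_one : IsWeakSphericalDiagram (CartanMatrix.A 1) (fun _ => 1) ∅
  /-- `Aₙ`, `n ≥ 2`, `σ = α₁ + ⋯ + αₙ`, white are `α₁` and `αₙ`. -/
  | A (n : ℕ) (hn : 2 ≤ n) :
      IsWeakSphericalDiagram (CartanMatrix.A n) (fun _ => 1)
        {i | i.val ≠ 0 ∧ i.val + 1 ≠ n}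
  /-- `Bₙ`, `n ≥ 2`, `σ = α₁ + ⋯ + αₙ`, white is `α₁` (and `αₙ` is short). -/
  | B (n : ℕ) (hn : 2 ≤ n) :
      IsWeakSphericalDiagram (CartanMatrix.B n) (fun _ => 1) {i | i.val ≠ 0}
  /-- `Bₙ`, `n ≥ 2`, `σ = α₁ + ⋯ + αₙ`, white are `α₁` and `αₙ` (and `αₙ` is short). -/
  | B' (n : ℕ) (hn : 2 ≤ n) :
      IsWeakSphericalDiagram (CartanMatrix.B n) (fun _ => 1)
        {i | i.val ≠ 0 ∧ i.val + 1 ≠ n}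
  /-- `Cₙ`, `n ≥ 3`, `σ = α₁ + 2α₂ + ⋯ + 2αₙ₋₁ + αₙ`, white is `α₂` (and `αₙ` is long). -/
  | C (n : ℕ) (hn : 3 ≤ n) :
      IsWeakSphericalDiagram (CartanMatrix.C n)
        (fun i => if i.val = 0 ∨ i.val + 1 = n then 1 else 2) {i | i.val ≠ 1}
  /-- `Cₙ`, `n ≥ 3`, `σ = α₁ + 2α₂ + ⋯ + 2αₙ₋₁ + αₙ`, white are `α₁` and `α₂`
  (and `αₙ` is long). -/
  | C' (n : ℕ) (hn : 3 ≤ n) :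
      IsWeakSphericalDiagram (CartanMatrix.C n)
        (fun i => if i.val = 0 ∨ i.val + 1 = n then 1 else 2) {i | i.val ≠ 0 ∧ i.val ≠ 1}
  /-- `F₄`, `σ = α₁ + 2α₂ + 3α₃ + 2α₄`, white is `α₄` (and `α₃`, `α₄` are short). -/
  | F_four : IsWeakSphericalDiagram CartanMatrix.F₄ ![1, 2, 3, 2] {i | i ≠ 3}
  /-- `G₂`, `σ = 2α_short + α_long`, white is `α_short`. Vertex `0` is the long root. -/
  | G_two : IsWeakSphericalDiagram CartanMatrix.G₂ ![1, 2] {0}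
  /-- `G₂`, `σ = α_short + α_long`, both vertices are white. -/
  | G_two' : IsWeakSphericalDiagram CartanMatrix.G₂ ![1, 1] ∅
  /-- `D₂ = A₁ × A₁`, `σ = α₁ + α₂`, both vertices are white. -/
  | D_two : IsWeakSphericalDiagram (CartanMatrix.D 2) (fun _ => 1) ∅
  /-- `Dₙ`, `n ≥ 3`, `σ = 2α₁ + ⋯ + 2αₙ₋₂ + αₙ₋₁ + αₙ`, white is `α₁`
  (`D₃` is `A₃` with `α₁` as middle vertex). -/
  | D (n : ℕ) (hn : 3 ≤ n) :
      IsWeakSphericalDiagram (CartanMatrix.D n)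
        (fun i => if i.val + 2 < n then 2 else 1) {i | i.val ≠ 0}
  /-- `B₃`, `σ = α₁ + 2α₂ + 3α₃`, white is `α₃` (and `α₃` is short). -/
  | B_three : IsWeakSphericalDiagram (CartanMatrix.B 3) ![1, 2, 3] {i | i ≠ 2}

section

variable {ι : Type v} {Λ : Type u} {Λv : Type w} [AddCommGroup Λ] [AddCommGroup Λv]

/-- `σ = ∑_{α ∈ |σ|} n_α α` for a set `|σ|` of simple roots (the range of `e`) such that
`(|σ|, n, |σ| ∩ S^p)` is, up to isomorphism, a row of the table of weak spherical roots.
The simple roots are the `P.root i`, `i ∈ b.support`, and `Sp` is a set of their indices. -/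
def IsWeakSphericalRoot (P : RootDatum ι Λ Λv) (b : P.Base) (Sp : Set ι) (σ : Λ) : Prop :=
  ∃ (n : ℕ) (C : Matrix (Fin n) (Fin n) ℤ) (label : Fin n → ℕ) (black : Set (Fin n))
    (e : Fin n ↪ ι),
    IsWeakSphericalDiagram C label black ∧
    (∀ k, e k ∈ b.support) ∧
    (∀ k l, P.pairing (e k) (e l) = C k l) ∧
    (∀ k, e k ∈ Sp ↔ k ∈ black) ∧
    σ = ∑ k, label k • P.root (e k)

/-- `(Ξ, Sig, Sp)` is a weak spherical system with respect to the based root datum `(P, b)`.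
Simple roots are referred to by their indices, the elements of `b.support`. -/
structure IsWeakSphericalSystem (P : RootDatum ι Λ Λv) (b : P.Base)
    (Ξ : AddSubgroup Λ) (Sig : Set Λ) (Sp : Set ι) : Prop where
  subset_lattice : Sig ⊆ Ξ
  subset_simple : Sp ⊆ b.support
  root : ∀ σ ∈ Sig, IsWeakSphericalRoot P b Sp σ
  orthogonal : ∀ i ∈ Sp, ∀ χ ∈ Ξ, P.toLinearMap χ (P.coroot i) = 0
  type_D_two : ∀ i ∈ b.support, ∀ j ∈ b.support, P.pairing i j = 0 →
    P.root i + P.root j ∈ Sig → ∀ χ ∈ Ξ, P.toLinearMap χ (P.coroot i - P.coroot j) = 0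
  pairing_ne : ∀ i ∈ b.support, ∀ j ∈ b.support, P.root i ∈ Sig →
    P.root i + P.root j ∈ Sig → P.pairing j i ≠ -1

/-- `B` is a scalar product on `Λ ⊗ ℝ`, invariant under the Weyl group (equivalently, under the
reflections, which generate it). -/
structure IsWeylInvariantScalarProduct (P : RootDatum ι Λ Λv)
    (B : LinearMap.BilinForm ℝ (ℝ ⊗[ℤ] Λ)) : Prop where
  symm : ∀ x y, B x y = B y x
  pos : ∀ x, x ≠ 0 → 0 < B x x
  invariant : ∀ i x y, B ((P.reflection i).toLinearMap.baseChange ℝ x)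
    ((P.reflection i).toLinearMap.baseChange ℝ y) = B x y

/-- The value at `χ` of the coroot `σ^∨ = 2σ / ‖σ‖²`, that is `(χ, σ^∨) = 2 (χ, σ) / (σ, σ)`. -/
noncomputable def scalarCoroot (B : LinearMap.BilinForm ℝ (ℝ ⊗[ℤ] Λ)) (σ χ : Λ) : ℝ :=
  2 * B (1 ⊗ₜ[ℤ] χ) (1 ⊗ₜ[ℤ] σ) / B (1 ⊗ₜ[ℤ] σ) (1 ⊗ₜ[ℤ] σ)

end

/-- `(X, Δ, Y, Δ^∨)`, where `X` and `Y` are paired by `p` and `Δ^∨ = {co σ | σ ∈ Δ}`, is a based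
root datum: there is a finite reduced root datum on the lattices `X` and `Y`, with pairing `p`,
which has a base whose simple roots are exactly the elements of `Δ` and in which the coroot of a
simple root `σ` is `co σ`. (The values of `co` outside `Δ` are irrelevant.) -/
def IsBasedRootDatum {X : Type u} {Y : Type w} [AddCommGroup X] [AddCommGroup Y]
    (p : X →ₗ[ℤ] Y →ₗ[ℤ] ℤ) (Δ : Set X) (co : X → Y) : Prop :=
  Module.Finite ℤ X ∧ Module.Finite ℤ Y ∧
    ∃ (κ : Type u) (_ : Finite κ) (Q : RootDatum κ X Y) (c : Q.Base),
      Q.toLinearMap = p ∧ Q.IsReduced ∧ Q.root '' (c.support : Set κ) = Δ ∧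
        ∀ k ∈ c.support, Q.coroot k = co (Q.root k)

/-! The proof joins a general criterion to a study of angles.

Criterion (`isBasedRootDatum_of_obtuse`): pairwise obtuse lattice vectors with integral coroots, a
form positive definite on their span and no nontrivial nonnegative relation are simple roots. No
Weyl group is generated: the roots are all nonzero β in the span whose coroot 2β/‖β‖² is an integral
combination of the given coroots. They are finite in number and stable under their own reflections.
Write β = x - y with x, y its positive and negative parts. Then ‖x‖² and ‖y‖² are integral multiples
of ‖β‖², and obtuseness gives ‖β‖² ≥ ‖x‖² + ‖y‖². So x or y vanishes: every root has a sign.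

Angles (`form_nonpos`): on Ξ the black coroots (those in S^p) vanish, so only white vertices matter,
and the table collapses to three shapes (`IsTabulated`): one white vertex, two white vertices, or an
orthogonal pair. The coroot of σ is then an explicit integral combination of white simple coroots,
independent of the scalar product (`exists_coroot`). A simple coroot outside the support of σ is
nonpositive on σ, so only shared white vertices are delicate. There supports spread along black
paths (`ne_zero_of_black`), and evaluating (σ,τ) through either coroot gives the sign or a
contradiction. Condition 4 excludes the pair α, α+β of type A₂. Proportional labels on the white
vertices force equality (`eq_of_proportional`). -/

namespace ObtuseFamily

/-! ### Obtuse families of vectors with integral coroots -/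

variable {κ : Type*} {X : Type*} [AddCommGroup X]

/-- Disjoint supports kill the diagonal terms, the only ones that could be positive. -/
lemma form_sum_sum_nonpos (B : X →ₗ[ℤ] X →ₗ[ℤ] ℝ) (e : κ → X)
    (he : ∀ i j, i ≠ j → B (e i) (e j) ≤ 0)
    (s : Finset κ) (a b : κ → ℤ) (ha : ∀ i, 0 ≤ a i) (hb : ∀ i, 0 ≤ b i)
    (hab : ∀ i, a i * b i = 0) :
    B (∑ i ∈ s, a i • e i) (∑ i ∈ s, b i • e i) ≤ 0 := by
  simp only [map_sum, LinearMap.sum_apply, map_smul, LinearMap.smul_apply, Finset.smul_sum]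
  refine Finset.sum_nonpos fun i _ => Finset.sum_nonpos fun j _ => ?_
  rw [smul_smul, zsmul_eq_mul]
  by_cases hij : j = i
  · subst hij; simp only [mul_comm (b _), hab]; simp
  · have : 0 ≤ b i * a j := mul_nonneg (hb i) (ha j)
    exact mul_nonpos_of_nonneg_of_nonpos (by exact_mod_cast this) (he _ _ hij)

lemma posPart_mul_negPart_eq_zero (n : ℤ) : n⁺ * n⁻ = 0 := by
  rcases le_total 0 n with h | h
  · simp [negPart_of_nonneg h]
  · simp [posPart_of_nonpos h]

lemma sum_eq_pos_sub_neg (e : κ → X) (s : Finset κ) (n : κ → ℤ) :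
    ∑ i ∈ s, n i • e i = ∑ i ∈ s, (n i)⁺ • e i - ∑ i ∈ s, (n i)⁻ • e i := by
  rw [← Finset.sum_sub_distrib]
  exact Finset.sum_congr rfl fun i _ => by rw [← sub_smul, posPart_sub_negPart]

/-- A relation equates its positive and negative parts. This common vector has square length at most
0 by obtuseness, so it vanishes, and `hcone` kills both parts. -/
lemma linearIndependent (B : X →ₗ[ℤ] X →ₗ[ℤ] ℝ) (e : κ → X)
    (he : ∀ i j, i ≠ j → B (e i) (e j) ≤ 0)
    (hpos : ∀ x ∈ Submodule.span ℤ (Set.range e), x ≠ 0 → 0 < B x x)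
    (hcone : ∀ (s : Finset κ) (a : κ → ℤ), (∀ i, 0 ≤ a i) → ∑ i ∈ s, a i • e i = 0 →
      ∀ i ∈ s, a i = 0) : LinearIndependent ℤ e := by
  rw [linearIndependent_iff']
  intro s n hn
  have mem (a : κ → ℤ) : ∑ i ∈ s, a i • e i ∈ Submodule.span ℤ (Set.range e) :=
    Submodule.sum_mem _ fun i _ => Submodule.smul_mem _ _ (Submodule.subset_span ⟨i, rfl⟩)
  have hle := form_sum_sum_nonpos B e he s (fun i => (n i)⁺) (fun i => (n i)⁻)
    (fun i => posPart_nonneg _) (fun i => negPart_nonneg _)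
    (fun i => posPart_mul_negPart_eq_zero (n i))
  rw [sum_eq_pos_sub_neg, sub_eq_zero] at hn
  rw [← hn] at hle
  have h0 : ∑ i ∈ s, (n i)⁺ • e i = 0 := by
    by_contra h
    exact absurd (hpos _ (mem _) h) (not_lt.mpr hle)
  intro i hi
  have h1 := hcone s _ (fun i => posPart_nonneg _) h0 i hi
  have h2 := hcone s _ (fun i => negPart_nonneg _) (hn ▸ h0) i hi
  rw [← posPart_sub_negPart (n i), h1, h2, sub_zero]

/-- If all `n i * B (e i) (e i)` are integral multiples of `c`, then so is the square length of
`∑ i, n i • e i`. -/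
lemma exists_form_self_eq (B : X →ₗ[ℤ] X →ₗ[ℤ] ℝ) (symm : ∀ x y, B x y = B y x) (e : κ → X)
    (co : κ → Module.Dual ℤ X) (hco : ∀ i χ, (co i χ : ℝ) * B (e i) (e i) = 2 * B χ (e i))
    (n m : κ → ℤ) (c : ℝ) (hc : ∀ i, (m i : ℝ) * c = n i * B (e i) (e i)) (s : Finset κ) :
    ∃ k : ℤ, B (∑ i ∈ s, n i • e i) (∑ i ∈ s, n i • e i) = k * c := by
  classical
  induction s using Finset.induction_on with
  | empty => exact ⟨0, by simp⟩
  | insert i s hi ih =>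
    obtain ⟨k, hk⟩ := ih
    rw [Finset.sum_insert hi]
    set x := ∑ i ∈ s, n i • e i
    -- Adding `n i • e i` contributes 2 n_i B(x, e_i) + n_i² ‖e_i‖². Here 2 B(x, e_i) = co_i(x)
    -- ‖e_i‖², so both terms contain n_i ‖e_i‖² = m_i c.
    refine ⟨m i * co i x + n i * m i + k, ?_⟩
    simp only [map_add, LinearMap.add_apply, map_smul, LinearMap.smul_apply, hk, symm (e i) x,
      zsmul_eq_mul]
    push_cast
    linear_combination (-(co i x : ℝ) - n i) * hc i - n i * hco i x

/-- The (real) roots attached to a family of vectors `e` in a space with a form: the integral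
combinations `β` of the `e i` such that `2β / ‖β‖²` is an integral combination of the
`2 e i / ‖e i‖²`. -/
def IsRoot [Fintype κ] (B : X →ₗ[ℤ] X →ₗ[ℤ] ℝ) (e : κ → X) (β : X) : Prop :=
  β ≠ 0 ∧ ∃ n m : κ → ℤ, β = ∑ i, n i • e i ∧ ∀ i, (m i : ℝ) * B β β = n i * B (e i) (e i)

section

variable [Fintype κ] (B : X →ₗ[ℤ] X →ₗ[ℤ] ℝ) (symm : ∀ x y, B x y = B y x) (e : κ → X)
    (hpos : ∀ x ∈ Submodule.span ℤ (Set.range e), x ≠ 0 → 0 < B x x)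
    (co : κ → Module.Dual ℤ X) (hco : ∀ i χ, (co i χ : ℝ) * B (e i) (e i) = 2 * B χ (e i))

lemma sum_mem_span (n : κ → ℤ) : ∑ i, n i • e i ∈ Submodule.span ℤ (Set.range e) :=
  Submodule.sum_mem _ fun i _ => Submodule.smul_mem _ _ (Submodule.subset_span ⟨i, rfl⟩)

variable {B e} in
lemma IsRoot.mem_span {β : X} (h : IsRoot B e β) : β ∈ Submodule.span ℤ (Set.range e) := by
  obtain ⟨_, n, _, rfl, _⟩ := h
  exact sum_mem_span e n

variable {B e} in
include hpos in
lemma IsRoot.pos {β : X} (h : IsRoot B e β) : 0 < B β β := hpos β h.mem_span h.1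

lemma isRoot_self (h0 : ∀ i, e i ≠ 0) (i : κ) : IsRoot B e (e i) := by
  classical
  refine ⟨h0 i, Pi.single i 1, Pi.single i 1, ?_, fun j => ?_⟩
  · simp [Pi.single_apply]
  · by_cases hj : j = i
    · subst hj; simp
    · simp [hj]

include hco in
-- The coroot is ∑ m_i co_i. The second clause lets the coefficients `n` be prescribed, since
-- independence makes them unique.
lemma exists_coroot {β : X} (h : IsRoot B e β) :
    ∃ φ : Module.Dual ℤ X, (∀ χ, (φ χ : ℝ) * B β β = 2 * B χ β) ∧
      ∀ n : κ → ℤ, LinearIndependent ℤ e → β = ∑ i, n i • e i →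
        ∃ m : κ → ℤ, φ = ∑ i, m i • co i ∧ ∀ i, (m i : ℝ) * B β β = n i * B (e i) (e i) := by
  obtain ⟨h0, n, m, hn, hm⟩ := h
  refine ⟨∑ i, m i • co i, fun χ => ?_, fun n' hli hn' => ⟨m, rfl, ?_⟩⟩
  · have : B χ β = ∑ i, n i * B χ (e i) := by
      conv_lhs => rw [hn]
      simp [map_sum]
    rw [this]
    simp only [LinearMap.sum_apply, LinearMap.smul_apply, smul_eq_mul]
    push_cast
    rw [Finset.sum_mul, Finset.mul_sum]
    refine Finset.sum_congr rfl fun i _ => ?_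
    linear_combination (co i χ : ℝ) * hm i + n i * hco i χ
  · have : n' = n := by
      have := Fintype.linearIndependent_iff.mp hli (fun i => n' i - n i)
        (by simp [sub_smul, ← hn', ← hn])
      exact funext fun i => sub_eq_zero.mp (this i)
    rw [this]; exact hm

include symm hco hpos in
-- Roots are stable under reflection: the length is preserved, and the coroot of the image is γ^∨ -
-- γ^∨(β) β^∨, again integral.
lemma IsRoot.sub {β γ : X} (hβ : IsRoot B e β) (hγ : IsRoot B e γ) (φ : Module.Dual ℤ X)
    (hφ : ∀ χ, (φ χ : ℝ) * B β β = 2 * B χ β) : IsRoot B e (γ - φ γ • β) := by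
  obtain ⟨ψ, hψ, -⟩ := exists_coroot B e co hco hγ
  have hββ := hβ.pos hpos
  have hγγ := hγ.pos hpos
  obtain ⟨-, n, m, hn, hm⟩ := hβ
  obtain ⟨-, n', m', hn', hm'⟩ := hγ
  have hnorm : B (γ - φ γ • β) (γ - φ γ • β) = B γ γ := by
    simp only [map_sub, LinearMap.sub_apply, map_smul, LinearMap.smul_apply, zsmul_eq_mul,
      symm β γ]
    linear_combination (φ γ : ℝ) * hφ γ
  refine ⟨fun h => ?_, fun i => n' i - φ γ * n i, fun i => m' i - ψ β * m i, ?_, fun i => ?_⟩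
  · rw [h] at hnorm; simp at hnorm; exact hγγ.ne hnorm
  · rw [hn', hn]
    simp only [sub_smul, Finset.sum_sub_distrib, mul_smul, Finset.smul_sum]
  · rw [hnorm]
    push_cast
    have h1 := hψ β
    rw [symm β γ] at h1
    linear_combination hm' i - (m i : ℝ) * h1 + (m i : ℝ) * hφ γ - φ γ * hm i

include symm hco hpos in
/-- The sign of a root: the coefficients are all nonnegative or all nonpositive. -/
lemma IsRoot.nonneg_or_nonpos (he : ∀ i j, i ≠ j → B (e i) (e j) ≤ 0)
    (hli : LinearIndependent ℤ e) {β : X} (hβ : IsRoot B e β) (n : κ → ℤ)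
    (hn : β = ∑ i, n i • e i) : (∀ i, 0 ≤ n i) ∨ (∀ i, n i ≤ 0) := by
  obtain ⟨φ, -, h⟩ := exists_coroot B e co hco hβ
  obtain ⟨m, -, hm⟩ := h n hli hn
  have hc := hβ.pos hpos
  have hne (i : κ) : 0 < B (e i) (e i) := hpos _ (Submodule.subset_span ⟨i, rfl⟩) (hli.ne_zero i)
  have hmn (i : κ) : 0 ≤ n i ↔ 0 ≤ m i := by
    have := hm i
    constructor
    · intro hi
      have h1 : 0 ≤ (m i : ℝ) * B β β := this ▸ mul_nonneg (by exact_mod_cast hi) (hne i).le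
      exact_mod_cast nonneg_of_mul_nonneg_left h1 hc
    · intro hi
      have h1 : 0 ≤ (n i : ℝ) * B (e i) (e i) := this ▸ mul_nonneg (by exact_mod_cast hi) hc.le
      exact_mod_cast nonneg_of_mul_nonneg_left h1 (hne i)
  -- Since `n i` and `m i` have the same sign, truncating both keeps the integrality relation; hence
  -- ‖x‖² and ‖y‖² are integral multiples of ‖β‖².
  have hmp (i : κ) : ((if 0 ≤ m i then m i else 0 : ℤ) : ℝ) * B β β = ((n i)⁺ : ℤ) * B (e i) (e i) := by
    by_cases hi : 0 ≤ n i
    · rw [if_pos ((hmn i).mp hi), posPart_of_nonneg hi, hm]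
    · rw [if_neg (fun h => hi ((hmn i).mpr h)), posPart_of_nonpos (not_le.mp hi).le]; simp
  have hmq (i : κ) : ((if 0 ≤ m i then 0 else -m i : ℤ) : ℝ) * B β β = ((n i)⁻ : ℤ) * B (e i) (e i) := by
    by_cases hi : 0 ≤ n i
    · rw [if_pos ((hmn i).mp hi), negPart_of_nonneg hi]; simp
    · rw [if_neg (fun h => hi ((hmn i).mpr h)), negPart_of_nonpos (not_le.mp hi).le]
      push_cast
      linear_combination - hm i
  obtain ⟨k, hk⟩ := exists_form_self_eq B symm e co hco _ _ _ hmp Finset.univ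
  obtain ⟨l, hl⟩ := exists_form_self_eq B symm e co hco _ _ _ hmq Finset.univ
  have hle := form_sum_sum_nonpos B e he Finset.univ (fun i => (n i)⁺) (fun i => (n i)⁻)
    (fun i => posPart_nonneg _) (fun i => negPart_nonneg _)
    (fun i => posPart_mul_negPart_eq_zero (n i))
  have hn2 := hn
  rw [sum_eq_pos_sub_neg] at hn2
  have hx := sum_mem_span e (fun i => (n i)⁺)
  have hy := sum_mem_span e (fun i => (n i)⁻)
  have hx0 : ∑ i, (n i)⁺ • e i = 0 → ∀ i, n i ≤ 0 := fun h i =>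
    posPart_eq_zero.mp (Fintype.linearIndependent_iff.mp hli _ h i)
  have hy0 : ∑ i, (n i)⁻ • e i = 0 → ∀ i, 0 ≤ n i := fun h i =>
    negPart_eq_zero.mp (Fintype.linearIndependent_iff.mp hli _ h i)
  set x := ∑ i, (n i)⁺ • e i
  set y := ∑ i, (n i)⁻ • e i
  by_contra! hcon
  have hx1 : x ≠ 0 := fun h => by
    obtain ⟨i, hi⟩ := hcon.2
    exact absurd (hx0 h i) (not_le.mpr hi)
  have hy1 : y ≠ 0 := fun h => by
    obtain ⟨i, hi⟩ := hcon.1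
    exact absurd (hy0 h i) (not_le.mpr hi)
  have hxx := hpos x hx hx1
  have hyy := hpos y hy hy1
  -- If both parts were nonzero, each would have square length at least ‖β‖², whereas B(x, y) ≤ 0
  -- bounds the sum of the two by ‖β‖².
  have one_le {k : ℤ} {b : ℝ} (h : b = k * B β β) (hb : 0 < b) : B β β ≤ b := by
    have : 0 < (k : ℝ) := pos_of_mul_pos_left (h ▸ hb) hc.le
    have : (1 : ℝ) ≤ k := by exact_mod_cast this
    nlinarith
  have h1 := one_le hk hxx
  have h2 := one_le hl hyy
  have h3 : B β β = B x x + B y y - 2 * B x y := by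
    rw [hn2]
    simp only [map_sub, LinearMap.sub_apply, symm y x]
    ring
  linarith

include symm hco hpos in
-- A root is determined by its values under the `co i`, which are integers bounded by a
-- Cauchy–Schwarz argument.
lemma finite_isRoot (h0 : ∀ i, e i ≠ 0) : {β | IsRoot B e β}.Finite := by
  classical
  refine Set.Finite.of_injOn (f := fun β i => co i β)
    (t := Set.Icc (fun _ => -4) (fun _ => 4)) ?_ ?_ (Set.finite_Icc _ _)
  · intro β hβ
    obtain ⟨φ, hφ, -⟩ := exists_coroot B e co hco hβ
    have hββ := IsRoot.pos hpos hβ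
    have nonneg (x : X) (hx : x ∈ Submodule.span ℤ (Set.range e)) : 0 ≤ B x x := by
      by_cases h : x = 0
      · simp [h]
      · exact (hpos x hx h).le
    have key (i : κ) : co i β ^ 2 ≤ 4 ^ 2 := by
      have he : e i ∈ Submodule.span ℤ (Set.range e) := Submodule.subset_span ⟨i, rfl⟩
      have h1 := hco i β
      have h2 := hφ (e i)
      rw [symm (e i) β] at h2
      have hee := hpos _ he (h0 i)
      -- Nonnegativity of ‖p e_i - 2β‖² and ‖q β - 2 e_i‖², with p = co_i(β) and q = β^∨(e_i),
      -- yields p²q² ≤ 16. The crude bound |p| ≤ 4 follows because q = 0 forces p = 0.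
      have h3 := nonneg _ (Submodule.sub_mem _ (Submodule.smul_mem _ (co i β) he)
          (Submodule.smul_mem _ 2 (IsRoot.mem_span hβ)))
      have h4 := nonneg _ (Submodule.sub_mem _
          (Submodule.smul_mem _ (φ (e i)) (IsRoot.mem_span hβ)) (Submodule.smul_mem _ 2 he))
      simp only [map_sub, LinearMap.sub_apply, map_smul, LinearMap.smul_apply, zsmul_eq_mul,
        symm (e i) β] at h3 h4
      push_cast at h3 h4
      set p := co i β
      set q := φ (e i)
      have h5 : (p : ℝ) ^ 2 * B (e i) (e i) ≤ 4 * B β β := by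
        linear_combination h3 + 2 * p * h1
      have h6 : (q : ℝ) ^ 2 * B β β ≤ 4 * B (e i) (e i) := by
        linear_combination h4 + 2 * q * h2
      have h7 : p ^ 2 * q ^ 2 ≤ 16 := by
        have : (p ^ 2 * q ^ 2 : ℝ) * (B (e i) (e i) * B β β) ≤ 16 * (B (e i) (e i) * B β β) := by
          have := mul_le_mul h5 h6 (by positivity) (by positivity)
          linear_combination this
        exact_mod_cast le_of_mul_le_mul_right this (by positivity)
      by_cases hq : q = 0
      · have : (p : ℝ) * B (e i) (e i) = 0 := by rw [h1, ← h2, hq]; simp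
        have : p = 0 := by simpa [hee.ne'] using this
        rw [this]; norm_num
      · have : 0 < q ^ 2 := by positivity
        nlinarith [sq_nonneg p]
    exact ⟨fun i => (abs_le_of_sq_le_sq' (key i) (by norm_num)).1,
      fun i => (abs_le_of_sq_le_sq' (key i) (by norm_num)).2⟩
  · intro β hβ γ hγ h
    have hi (i : κ) : B (β - γ) (e i) = 0 := by
      have h1 := hco i β
      have h2 := hco i γ
      have h3 : co i β = co i γ := congrFun h i
      rw [h3] at h1
      simp only [map_sub, LinearMap.sub_apply]
      linarith
    have hmem := Submodule.sub_mem _ (IsRoot.mem_span hβ) (IsRoot.mem_span hγ)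
    by_contra hne
    refine (hpos _ hmem (sub_ne_zero.mpr hne)).ne' ?_
    have : Submodule.span ℤ (Set.range e) ≤ LinearMap.ker (B (β - γ)) := by
      rw [Submodule.span_le]
      rintro _ ⟨i, rfl⟩
      exact hi i
    exact this hmem

end

end ObtuseFamily

/-! ### The based root datum of an obtuse family -/

open ObtuseFamily in
/-- A set of vectors in a lattice which is obtuse for a scalar product, with integral coroots and
without nontrivial relations with nonnegative coefficients, is the set of simple roots of a based root datum. -/
theorem isBasedRootDatum_of_obtuse {X : Type u} [AddCommGroup X] [Module.Finite ℤ X]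
    [Module.Free ℤ X] (B : X →ₗ[ℤ] X →ₗ[ℤ] ℝ) (symm : ∀ x y, B x y = B y x)
    (Δ : Set X) (co : X → Module.Dual ℤ X)
    (hco : ∀ σ ∈ Δ, ∀ χ, (co σ χ : ℝ) * B σ σ = 2 * B χ σ)
    (hpos : ∀ x ∈ Submodule.span ℤ Δ, x ≠ 0 → 0 < B x x)
    (hle : ∀ σ ∈ Δ, ∀ τ ∈ Δ, σ ≠ τ → B σ τ ≤ 0)
    (hcone : ∀ (s : Finset Δ) (a : Δ → ℤ), (∀ i, 0 ≤ a i) → ∑ i ∈ s, a i • (i : X) = 0 →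
      ∀ i ∈ s, a i = 0) :
    IsBasedRootDatum (Module.Dual.eval ℤ X) Δ co := by
  classical
  refine ⟨inferInstance, inferInstance, ?_⟩
  let e : Δ → X := Subtype.val
  let c : Δ → Module.Dual ℤ X := fun i => co i
  have hspan : Submodule.span ℤ (Set.range e) = Submodule.span ℤ Δ := by
    rw [Subtype.range_coe]
  rw [← hspan] at hpos
  have he : ∀ i j, i ≠ j → B (e i) (e j) ≤ 0 := fun i j hij =>
    hle i i.2 j j.2 fun h => hij (Subtype.ext h)
  have hc : ∀ i χ, (c i χ : ℝ) * B (e i) (e i) = 2 * B χ (e i) := fun i χ => hco i i.2 χ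
  have hli : LinearIndependent ℤ e :=
    linearIndependent B e he hpos hcone
  have : Finite Δ := hli.finite_of_isNoetherian
  have : Fintype Δ := Fintype.ofFinite Δ
  have h0 := hli.ne_zero
  have hee (i : Δ) : 0 < B (e i) (e i) := hpos _ (Submodule.subset_span ⟨i, rfl⟩) (h0 i)
  let κ : Type u := {β : X // IsRoot B e β}
  have hfin : Finite κ := finite_isRoot B symm e hpos c hc h0
  have hex (β : κ) := exists_coroot B e c hc β.2
  choose φ hφ hφm using hex
  have hpp (β : κ) : 0 < B β.1 β.1 := β.2.pos hpos
  have ext {f g : Module.Dual ℤ X} {a : ℝ} (ha : 0 < a) (h : ∀ χ, (f χ : ℝ) * a = g χ * a) :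
      f = g :=
    LinearMap.ext fun χ => by exact_mod_cast mul_right_cancel₀ ha.ne' (h χ)
  have hsub (β γ : κ) : IsRoot B e (γ.1 - φ β γ.1 • β.1) := β.2.sub B symm e hpos c hc γ.2 _ (hφ β)
  have two (β : κ) : φ β β.1 = 2 := by
    exact_mod_cast mul_right_cancel₀ (hpp β).ne' (hφ β β.1)
  have hnorm (β γ : κ) : B (γ.1 - φ β γ.1 • β.1) (γ.1 - φ β γ.1 • β.1) = B γ.1 γ.1 := by
    have := hφ β γ.1
    simp only [map_sub, LinearMap.sub_apply, map_smul, LinearMap.smul_apply, zsmul_eq_mul,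
      symm β.1 γ.1]
    linear_combination (φ β γ.1 : ℝ) * this
  have inj : Function.Injective φ := by
    intro β γ h
    have h1 := hφ β γ.1
    have h2 := hφ γ β.1
    rw [h, two] at h1
    rw [← h, two, symm β.1] at h2
    push_cast at h1 h2
    by_contra hne
    have h3 := hpos _ (Submodule.sub_mem _ β.2.mem_span γ.2.mem_span)
      (sub_ne_zero.mpr fun h => hne (Subtype.ext h))
    simp only [map_sub, LinearMap.sub_apply, symm β.1 γ.1] at h3
    linarith
  let Q : RootDatum κ X (Module.Dual ℤ X) := RootPairing.mk' (Module.Dual.eval ℤ X)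
    ⟨Subtype.val, Subtype.val_injective⟩ ⟨φ, inj⟩ two
    (by
      rintro β _ ⟨γ, rfl⟩
      exact ⟨⟨_, hsub β γ⟩, rfl⟩)
    (by
      rintro β _ ⟨γ, rfl⟩
      refine ⟨⟨_, hsub β γ⟩, ?_⟩
      change φ ⟨_, hsub β γ⟩ = φ γ - φ γ β.1 • φ β
      -- A functional is tested after multiplication by a positive square length, where coroots
      -- become values of the form.
      refine ext (hpp γ) fun χ => ?_
      have h1 := hφ ⟨_, hsub β γ⟩ χ
      have h2 := hφ β χ
      have h3 := hφ γ χ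
      have h4 := hφ γ β.1
      have h5 := hφ β γ.1
      rw [symm β.1 γ.1] at h4
      dsimp only at h1
      rw [hnorm] at h1
      simp only [map_sub, map_smul, zsmul_eq_mul] at h1
      simp only [LinearMap.sub_apply, LinearMap.smul_apply, smul_eq_mul]
      push_cast
      linear_combination h1 - h3 + φ β χ * h4 - φ β χ * h5 + φ β γ.1 * h2)
  have hQr (β : κ) : Q.root β = β.1 := rfl
  have hQc (β : κ) : Q.coroot β = φ β := rfl
  let s : Δ → κ := fun i => ⟨e i, isRoot_self B e h0 i⟩
  have hs : Function.Injective s := fun i j h => Subtype.ext (congrArg (fun x : κ => x.1) h)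
  have hφs (i : Δ) : φ (s i) = c i := ext (hee i) fun χ => by
    rw [hc]; exact hφ (s i) χ
  -- A relation among the coroots makes the Cartan matrix singular. A kernel vector on the other
  -- side gives a combination of the `e j` orthogonal to every `e i`, hence zero by definiteness.
  have hcli : LinearIndependent ℤ c := by
    rw [Fintype.linearIndependent_iff]
    intro g hg
    by_contra! hne
    have hv : Matrix.vecMul g (Matrix.of fun i j => c i (e j)) = 0 := by
      funext j
      have := DFunLike.congr_fun hg (e j)
      simpa [Matrix.vecMul, dotProduct] using this
    obtain ⟨i₀, hi₀⟩ := hne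
    have hdet := Matrix.exists_vecMul_eq_zero_iff.mp ⟨g, fun h => hi₀ (congrFun h i₀), hv⟩
    obtain ⟨h, hh, hh0⟩ := Matrix.exists_mulVec_eq_zero_iff.mpr hdet
    have hx (i : Δ) : B (∑ j, h j • e j) (e i) = 0 := by
      have h1 := hc i (∑ j, h j • e j)
      have h2 : c i (∑ j, h j • e j) = 0 := by
        have := congrFun hh0 i
        simpa [Matrix.mulVec, dotProduct, mul_comm] using this
      rw [h2] at h1
      simpa using h1.symm
    have hx0 : ∑ j, h j • e j = 0 := by
      by_contra hne
      refine (hpos _ (sum_mem_span e h) hne).ne' ?_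
      conv_lhs => rw [map_sum]
      simp only [map_smul, hx, smul_zero, Finset.sum_const_zero]
    exact hh (funext (Fintype.linearIndependent_iff.mp hli h hx0))
  have hcomb (n : Δ → ℤ) (hn : ∀ i, 0 ≤ n i) {Y : Type u} [AddCommGroup Y]
      (f : Δ → Y) :
      ∑ i, n i • f i ∈ AddSubmonoid.closure (Set.range f) :=
    AddSubmonoid.sum_mem _ fun i _ => by
      lift n i to ℕ using hn i with k
      rw [natCast_zsmul]
      exact AddSubmonoid.nsmul_mem _ (AddSubmonoid.subset_closure (Set.mem_range_self i)) _
  have hsgn (β : κ) : ∃ n : Δ → ℤ, β.1 = ∑ i, n i • e i ∧ ((∀ i, 0 ≤ n i) ∨ ∀ i, n i ≤ 0) := by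
    obtain ⟨n, m, hn, -⟩ := β.2.2
    exact ⟨n, hn, β.2.nonneg_or_nonpos B symm e hpos c hc he hli n hn⟩
  -- The coroot of kβ is β^∨/k. Its integrality makes ‖β‖² an integral multiple of k‖β‖², so k is a
  -- unit.
  have hprim (β γ : κ) (k : ℤ) (h : γ.1 = k • β.1) : k = 1 ∨ k = -1 := by
    obtain ⟨n, m, hn, -⟩ := β.2.2
    have hγ : γ.1 = ∑ i, (k * n i) • e i := by rw [h, hn]; simp [Finset.smul_sum, mul_smul]
    obtain ⟨m, -, hm⟩ := hφm γ _ hli hγ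
    have hk : (k : ℝ) ≠ 0 := by
      rintro hk
      have : k = 0 := by exact_mod_cast hk
      exact γ.2.1 (by rw [h, this, zero_smul])
    obtain ⟨l, hl⟩ := exists_form_self_eq B symm e c hc n m (k * B β.1 β.1) (fun i => by
      have := hm i
      rw [h] at this
      simp only [map_smul, LinearMap.smul_apply, zsmul_eq_mul] at this
      push_cast at this
      exact mul_left_cancel₀ hk (by linear_combination this)) Finset.univ
    rw [← hn, ← mul_assoc] at hl
    have : (l * k : ℝ) = 1 := mul_right_cancel₀ (hpp β).ne' (by rw [one_mul]; exact hl.symm)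
    exact Int.eq_one_or_neg_one_of_mul_eq_one (u := k) (v := l)
      (by rw [mul_comm]; exact_mod_cast this)
  have hsupp : ((Finset.univ.map ⟨s, hs⟩ : Finset κ) : Set κ) = Set.range s := by simp
  let b : Q.Base :=
    { support := Finset.univ.map ⟨s, hs⟩
      linearIndepOn_root := by
        rw [hsupp, linearIndepOn_range_iff hs]
        exact hli
      linearIndepOn_coroot := by
        rw [hsupp, linearIndepOn_range_iff hs]
        have : Q.coroot ∘ s = c := funext hφs
        rw [this]
        exact hcli
      root_mem_or_neg_mem := fun β => by
        rw [hsupp, ← Set.range_comp]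
        obtain ⟨n, hn, h⟩ := hsgn β
        change β.1 ∈ AddSubmonoid.closure (Set.range e) ∨ -β.1 ∈ AddSubmonoid.closure (Set.range e)
        rw [hn, ← Finset.sum_neg_distrib]
        simp_rw [← neg_smul]
        exact h.imp (fun h => hcomb _ h e) fun h => hcomb _ (fun i => neg_nonneg.mpr (h i)) e
      coroot_mem_or_neg_mem := fun β => by
        have hcs : Q.coroot ∘ s = c := funext hφs
        rw [hsupp, ← Set.range_comp, hcs]
        obtain ⟨n, hn, h⟩ := hsgn β
        obtain ⟨m, hm, hmn⟩ := hφm β n hli hn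
        change φ β ∈ AddSubmonoid.closure (Set.range c) ∨ -φ β ∈ AddSubmonoid.closure (Set.range c)
        rw [hm, ← Finset.sum_neg_distrib]
        simp_rw [← neg_smul]
        refine h.imp (fun h => hcomb _ (fun i => ?_) c) fun h => hcomb _ (fun i => ?_) c
        · have h1 : 0 ≤ (m i : ℝ) * B β.1 β.1 :=
            hmn i ▸ mul_nonneg (by exact_mod_cast h i) (hee i).le
          exact_mod_cast nonneg_of_mul_nonneg_left h1 (hpp β)
        · have h1 : 0 ≤ (-m i : ℝ) * B β.1 β.1 := by
            rw [neg_mul, hmn i, ← neg_mul]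
            exact mul_nonneg (by exact_mod_cast neg_nonneg.mpr (h i)) (hee i).le
          exact_mod_cast nonneg_of_mul_nonneg_left h1 (hpp β) }
  refine ⟨κ, hfin, Q, b, rfl, ⟨?_⟩, ?_, ?_⟩
  · intro β γ h
    have h1 := Q.pairing_smul_root_eq_of_not_linearIndependent h
    rw [LinearIndependent.pair_symm_iff] at h
    have h2 := Q.pairing_smul_root_eq_of_not_linearIndependent h
    set p := Q.pairing γ β
    set q := Q.pairing β γ
    -- Proportional roots have Cartan integers of product 4, so one is even and one root is an
    -- integral multiple of the other; `hprim` then applies.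
    have hpq : p * q = 4 := by
      refine smul_left_injective ℤ (Q.ne_zero β) ?_
      simp only
      rw [mul_comm, mul_smul, h1, smul_comm, h2, smul_smul]
      norm_num
    have half {k : ℤ} {x y : X} (h : (2 * k) • x = (2 : ℤ) • y) : y = k • x :=
      smul_right_injective X (two_ne_zero (α := ℤ)) (by simp only; rw [← h, mul_smul])
    obtain ⟨k, hk⟩ | ⟨k, hk⟩ : Even p ∨ Even q := Int.even_mul.mp (hpq ▸ by decide)
    · have h3 := half (by rw [← h1, hk, two_mul])
      rcases hprim β γ k h3 with rfl | rfl
      · left; rw [h3, one_smul]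
      · right; rw [h3, neg_one_smul, neg_neg]
    · have h3 := half (by rw [← h2, hk, two_mul])
      rcases hprim γ β k h3 with rfl | rfl
      · left; rw [h3, one_smul]
      · right; rw [h3, neg_one_smul]
  · change Q.root '' ((Finset.univ.map ⟨s, hs⟩ : Finset κ) : Set κ) = Δ
    rw [hsupp, ← Set.range_comp]
    exact Subtype.range_coe
  · intro k hk
    obtain ⟨i, -, rfl⟩ := Finset.mem_map.mp hk
    exact hφs i

namespace WeakSpherical

/-! ### The three shapes of weak spherical roots -/

section Diagrams

variable {I : Type*} (C : I → I → ℤ) (f : I → ℕ) (S : Set I) (v : I → ℤ)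

/-- Squared lengths `N i` of vectors with Cartan matrix `C`. -/
structure IsLength (N : I → ℝ) : Prop where
  pos : ∀ i, 0 < N i
  mul_comm : ∀ i j, N j * C i j = N i * C j i

/-- `d` can be joined to `w` inside the support of `f` by a path whose vertices other than `w` are
black. -/
def IsBlackReachable (w d : I) : Prop :=
  ∀ K : Set I, w ∈ K → (∀ k ∈ K, ∀ l ∈ S, f l ≠ 0 → C k l ≠ 0 → l ∈ K) → d ∈ K

/-- The properties shared by the weak spherical roots with one white vertex `w`.
Here `f` is the labelling, `S` the set of black vertices and `v` lists the values of the simple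
coroots on the root. -/
structure IsOneWhite (w : I) : Prop where
  label_ne : f w ≠ 0
  notMem : w ∉ S
  black : ∀ i, f i ≠ 0 → i ≠ w → i ∈ S
  val : v w = 1 ∨ v w = 2
  -- The premise of `lt` holds only for A₁; that of `le` also for Bₙ and Dₙ, where the white vertex
  -- is never shorter than the others.
  lt : (f w : ℤ) < v w → ∀ i, f i ≠ 0 → i = w
  le : (f w : ℤ) ≤ v w → ∀ N, IsLength C N → ∀ i, f i ≠ 0 → N i ≤ N w

/-- The properties shared by the weak spherical roots with connected support and two white vertices
`w₁` and `w₂`; the coroot is `r w₁^∨ + w₂^∨` up to black coroots. -/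
structure IsTwoWhite (w₁ w₂ : I) (r : ℤ) : Prop where
  ne : w₁ ≠ w₂
  notMem₁ : w₁ ∉ S
  notMem₂ : w₂ ∉ S
  black : ∀ i, f i ≠ 0 → i ≠ w₁ → i ≠ w₂ → i ∈ S
  label₁ : f w₁ = 1 ∨ f w₁ = 2
  label₂ : f w₂ = 1
  one_le : 1 ≤ r
  -- Coroot coefficients are proportional to label times square length. Then σ^∨(σ) = 2 reads r · 1
  -- + (2 - r) = 2.
  length : ∀ N, IsLength C N → f w₁ * N w₁ = r * N w₂
  val₁ : v w₁ = 1
  val₂ : v w₂ = 2 - r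
  -- `d` is the neighbour of `w₂` on the side of `w₁`: another root containing `w₁` but not `w₂`
  -- must contain `d`, and so is negative on w₂^∨.
  reach : ∃ d, f d ≠ 0 ∧ IsBlackReachable C f S w₁ d ∧ f w₁ * C d w₂ = -r ∧
    (f w₁ = 1 → d = w₁ → ∀ i, f i ≠ 0 → i = w₁ ∨ i = w₂) ∧ (f w₁ = 2 → d = w₁)
  -- Label 2 occurs only for Cₙ: `l` is the long end vertex, and `w₂` is the other end, adjacent
  -- only to `w₁`.
  long : f w₁ = 2 → ∃ l, f l ≠ 0 ∧ IsBlackReachable C f S w₁ l ∧ ∀ N, IsLength C N → N w₁ < N l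
  isolated : f w₁ = 2 → ∀ i ∈ S, f i ≠ 0 → C i w₂ = 0

/-- The properties of the weak spherical roots whose support consists of two orthogonal simple
roots `i` and `j`. -/
structure IsOrthogonalPair (i j : I) : Prop where
  ne : i ≠ j
  notMem₁ : i ∉ S
  notMem₂ : j ∉ S
  support : ∀ k, f k ≠ 0 → k = i ∨ k = j
  label₁ : f i = 1
  label₂ : f j = 1
  pairing : C i j = 0

/-- The trichotomy for weak spherical roots. -/
def IsTabulated : Prop :=
  (∃ w, IsOneWhite C f S v w) ∨
  (∃ w₁ w₂ r, IsTwoWhite C f S v w₁ w₂ r ∧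
    (v w₂ ≤ 0 ∨ ∃ r', IsTwoWhite C f S v w₂ w₁ r')) ∨
  ∃ i j, IsOrthogonalPair C f S i j

variable {C}

lemma IsLength.eq_of_eq {N : I → ℝ} (h : IsLength C N) {i j : I} (hij : C i j = C j i)
    (h0 : C i j ≠ 0) : N i = N j := by
  have := h.mul_comm i j
  rw [← hij] at this
  exact (mul_right_cancel₀ (by exact_mod_cast h0) this).symm

variable {f S}

lemma IsBlackReachable.refl (w : I) : IsBlackReachable C f S w w := fun _ h _ => h

lemma IsBlackReachable.step {w d l : I} (h : IsBlackReachable C f S w d) (hl : l ∈ S)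
    (hf : f l ≠ 0) (hC : C d l ≠ 0) : IsBlackReachable C f S w l :=
  fun K hw hK => hK d (h K hw hK) l hl hf hC

end Diagrams

/-! ### Transport of the shapes along an embedding of diagrams -/

section Transfer

variable {I J : Type*} {C : I → I → ℤ} {f : I → ℕ} {S : Set I} {v : I → ℤ}
  {C' : J → J → ℤ} {f' : J → ℕ} {S' : Set J} {v' : J → ℤ} (e : I ↪ J)
  (hC : ∀ i j, C' (e i) (e j) = C i j) (hf : ∀ i, f' (e i) = f i)
  (hf0 : ∀ j, f' j ≠ 0 → ∃ i, e i = j) (hS : ∀ i, e i ∈ S' ↔ i ∈ S)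
  (hv : ∀ i, v' (e i) = v i)

include hC in
lemma IsLength.comp {N : J → ℝ} (h : IsLength C' N) : IsLength C (N ∘ e) :=
  ⟨fun i => h.pos _, fun i j => by simpa [hC] using h.mul_comm (e i) (e j)⟩

include hC hf hS in
lemma IsBlackReachable.map {w d : I} (h : IsBlackReachable C f S w d) :
    IsBlackReachable C' f' S' (e w) (e d) := fun K hw hK =>
  h (e ⁻¹' K) hw fun k hk l hl hfl hkl =>
    hK _ hk _ ((hS l).mpr hl) (by rwa [hf]) (by rwa [hC])

include hC hf hf0 hS hv in
lemma IsOneWhite.map {w : I} (h : IsOneWhite C f S v w) : IsOneWhite C' f' S' v' (e w) where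
  label_ne := by rw [hf]; exact h.label_ne
  notMem := by rw [hS]; exact h.notMem
  black j hj hne := by
    obtain ⟨i, rfl⟩ := hf0 j hj
    rw [hS]
    exact h.black i (hf i ▸ hj) fun h => hne (h ▸ rfl)
  val := by rw [hv]; exact h.val
  lt hlt j hj := by
    obtain ⟨i, rfl⟩ := hf0 j hj
    rw [hf, hv] at hlt
    rw [h.lt hlt i (hf i ▸ hj)]
  le hle N hN j hj := by
    obtain ⟨i, rfl⟩ := hf0 j hj
    rw [hf, hv] at hle
    exact h.le hle _ (hN.comp e hC) i (hf i ▸ hj)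

include hC hf hf0 hS hv in
lemma IsTwoWhite.map {w₁ w₂ : I} {r : ℤ} (h : IsTwoWhite C f S v w₁ w₂ r) :
    IsTwoWhite C' f' S' v' (e w₁) (e w₂) r where
  ne hh := h.ne (e.injective hh)
  notMem₁ := by rw [hS]; exact h.notMem₁
  notMem₂ := by rw [hS]; exact h.notMem₂
  black j hj h1 h2 := by
    obtain ⟨i, rfl⟩ := hf0 j hj
    rw [hS]
    exact h.black i (hf i ▸ hj) (fun h => h1 (h ▸ rfl)) (fun h => h2 (h ▸ rfl))
  label₁ := by rw [hf]; exact h.label₁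
  label₂ := by rw [hf]; exact h.label₂
  one_le := h.one_le
  length N hN := by rw [hf]; exact h.length _ (hN.comp e hC)
  val₁ := by rw [hv]; exact h.val₁
  val₂ := by rw [hv]; exact h.val₂
  reach := by
    obtain ⟨d, hd, hr, hm, h1, h2⟩ := h.reach
    refine ⟨e d, by rwa [hf], hr.map e hC hf hS, by rwa [hf, hC], fun h3 h4 j hj => ?_,
      fun h3 => by rw [h2 (hf w₁ ▸ h3)]⟩
    obtain ⟨i, rfl⟩ := hf0 j hj
    exact (h1 (hf w₁ ▸ h3) (e.injective h4) i (hf i ▸ hj)).imp (congrArg e) (congrArg e)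
  long h2 := by
    obtain ⟨l, hl, hr, hN⟩ := h.long (hf w₁ ▸ h2)
    exact ⟨e l, by rwa [hf], hr.map e hC hf hS, fun N h => hN _ (h.comp e hC)⟩
  isolated h2 j hj hfj := by
    obtain ⟨i, rfl⟩ := hf0 j hfj
    rw [hC]
    exact h.isolated (hf w₁ ▸ h2) i ((hS i).mp hj) (hf i ▸ hfj)

include hC hf hf0 hS in
lemma IsOrthogonalPair.map {i j : I} (h : IsOrthogonalPair C f S i j) :
    IsOrthogonalPair C' f' S' (e i) (e j) where
  ne hh := h.ne (e.injective hh)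
  notMem₁ := by rw [hS]; exact h.notMem₁
  notMem₂ := by rw [hS]; exact h.notMem₂
  support k hk := by
    obtain ⟨k, rfl⟩ := hf0 k hk
    exact (h.support k (hf k ▸ hk)).imp (congrArg e) (congrArg e)
  label₁ := by rw [hf]; exact h.label₁
  label₂ := by rw [hf]; exact h.label₂
  pairing := by rw [hC]; exact h.pairing

include hC hf hf0 hS hv in
lemma IsTabulated.map (h : IsTabulated C f S v) : IsTabulated C' f' S' v' := by
  rcases h with ⟨w, h⟩ | ⟨w₁, w₂, r, h, h'⟩ | ⟨i, j, h⟩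
  · exact .inl ⟨e w, h.map e hC hf hf0 hS hv⟩
  · refine .inr (.inl ⟨e w₁, e w₂, r, h.map e hC hf hf0 hS hv, ?_⟩)
    rw [hv]
    exact h'.imp_right fun ⟨r', h'⟩ => ⟨r', h'.map e hC hf hf0 hS hv⟩
  · exact .inr (.inr ⟨e i, e j, h.map e hC hf hf0 hS⟩)

end Transfer

/-! ### Chains of vertices -/

section Chains

variable {n : ℕ} {C : Fin n → Fin n → ℤ} {f : Fin n → ℕ} {S : Set (Fin n)}

lemma isBlackReachable_of_chain {a b : ℕ} (hab : a ≤ b) (hb : b < n)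
    (h : ∀ k (hk : k + 1 < n), a ≤ k → k + 1 ≤ b →
      ⟨k + 1, hk⟩ ∈ S ∧ f ⟨k + 1, hk⟩ ≠ 0 ∧ C ⟨k, by lia⟩ ⟨k + 1, hk⟩ ≠ 0) :
    IsBlackReachable C f S ⟨a, by lia⟩ ⟨b, hb⟩ := by
  induction b, hab using Nat.le_induction with
  | base => exact .refl _
  | succ k hk ih =>
    obtain ⟨h1, h2, h3⟩ := h k hb hk le_rfl
    exact (ih (by lia) fun l hl hal hlk => h l hl hal (by lia)).step h1 h2 h3

lemma IsLength.eq_of_chain {N : Fin n → ℝ} (hN : IsLength C N) {a b : ℕ} (hab : a ≤ b) (hb : b < n)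
    (h : ∀ k (hk : k + 1 < n), a ≤ k → k + 1 ≤ b →
      C ⟨k, by lia⟩ ⟨k + 1, hk⟩ = -1 ∧ C ⟨k + 1, hk⟩ ⟨k, by lia⟩ = -1) :
    N ⟨b, hb⟩ = N ⟨a, by lia⟩ := by
  induction b, hab using Nat.le_induction with
  | base => rfl
  | succ k hk ih =>
    obtain ⟨h1, h2⟩ := h k hb hk le_rfl
    rw [← ih (by lia) fun l hl hal hlk => h l hl hal (by lia)]
    exact (hN.eq_of_eq (by rw [h1, h2]) (by rw [h1]; decide)).symm

end Chains

/-- The values of the simple coroots on a vector with labelling `f`. -/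
def values {n : ℕ} (C : Matrix (Fin n) (Fin n) ℤ) (f : Fin n → ℕ) (k : Fin n) : ℤ :=
  ∑ l, f l * C l k

/-! ### Verification of the table, type by type -/

open CartanMatrix

lemma isOneWhite_A_one : IsOneWhite (A 1) (fun _ => 1) ∅ (values (A 1) fun _ => 1) 0 where
  label_ne := one_ne_zero
  notMem := by simp
  black i _ h := absurd (Subsingleton.elim _ _) h
  val := .inr (by decide)
  lt _ i _ := Subsingleton.elim _ _
  le _ _ _ i _ := by rw [Subsingleton.elim i 0]

lemma isTwoWhite_A (m : ℕ) : IsTwoWhite (A (m + 2)) (fun _ => 1) {i | i.val ≠ 0 ∧ i.val + 1 ≠ m + 2}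
    (values (A (m + 2)) fun _ => 1) 0 (Fin.last (m + 1)) 1 where
  ne := by simp [Fin.ext_iff]
  notMem₁ := by simp
  notMem₂ := by simp
  black i _ h1 h2 := ⟨fun h => h1 (Fin.ext h), fun h => h2 (Fin.ext (Nat.succ.inj h))⟩
  label₁ := .inl rfl
  label₂ := rfl
  one_le := le_rfl
  length N hN := by
    have : N (Fin.last (m + 1)) = N 0 :=
      hN.eq_of_chain (zero_le (a := m + 1)) (by lia) fun k hk _ _ => by simp [A]
    simp [this]
  val₁ := by
    simp only [values]
    rw [Fin.sum_univ_succ, Fin.sum_univ_succ, Fintype.sum_eq_zero]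
    · simp [A]
    · intro i; simp [A, Fin.ext_iff]
  val₂ := by
    simp only [values]
    rw [Fin.sum_univ_castSucc, Fin.sum_univ_castSucc, Fintype.sum_eq_zero]
    · simp [A, Fin.ext_iff]
    · intro i; simp [A, Fin.ext_iff]; lia
  reach := by
    refine ⟨⟨m, by lia⟩, one_ne_zero, ?_, ?_, ?_, ?_⟩
    · refine isBlackReachable_of_chain (zero_le (a := m)) _ fun k hk _ _ => ?_
      simp [A]; lia
    · simp [A, Fin.ext_iff]
    · intro _ h i _
      obtain rfl : m = 0 := congrArg Fin.val h
      fin_cases i <;> simp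
    · simp
  long := by simp
  isolated := by simp

/-- The diagram automorphism of Aₙ exchanges the two white vertices. Type A is the only two-white
type with positive value at `w₂`, so it needs this symmetry. -/
lemma isTwoWhite_A_rev (m : ℕ) : IsTwoWhite (A (m + 2)) (fun _ => 1)
    {i | i.val ≠ 0 ∧ i.val + 1 ≠ m + 2}
    (values (A (m + 2)) fun _ => 1) (Fin.last (m + 1)) 0 1 := by
  have hA (i j : Fin (m + 2)) : A (m + 2) i.rev j.rev = A (m + 2) i j := by
    simp only [A, Matrix.of_apply, Fin.rev_inj, Fin.val_rev]
    grind
  have h := (isTwoWhite_A m).map (Fin.revPerm.toEmbedding) (C' := A (m + 2)) (f' := fun _ => 1)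
    (S' := {i | i.val ≠ 0 ∧ i.val + 1 ≠ m + 2}) (v' := values (A (m + 2)) fun _ => 1) hA
    (fun _ => rfl) (fun j _ => ⟨j.rev, by simp⟩) (fun i => by
      change (i.rev.val ≠ 0 ∧ i.rev.val + 1 ≠ m + 2) ↔ (i.val ≠ 0 ∧ i.val + 1 ≠ m + 2)
      rw [Fin.val_rev]
      lia) (fun i => by
      simp only [values]
      rw [← Equiv.sum_comp Fin.revPerm]
      simp [hA])
  simpa using h

lemma B_succ_succ_chain {m k : ℕ} (hk : k + 1 < m + 2) (h : k + 1 ≤ m) :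
    B (m + 2) ⟨k, by lia⟩ ⟨k + 1, hk⟩ = -1 ∧ B (m + 2) ⟨k + 1, hk⟩ ⟨k, by lia⟩ = -1 := by
  simp [B]; lia

lemma IsLength.B_eq {m : ℕ} {N : Fin (m + 2) → ℝ} (hN : IsLength (B (m + 2)) N) {k : ℕ}
    (hk : k ≤ m) : N ⟨k, by lia⟩ = N 0 :=
  hN.eq_of_chain (zero_le (a := k)) (by lia) fun _ hk' _ h => B_succ_succ_chain hk' (by lia)

lemma IsLength.B_last {m : ℕ} {N : Fin (m + 2) → ℝ} (hN : IsLength (B (m + 2)) N) :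
    N 0 = 2 * N (Fin.last _) := by
  have h := hN.mul_comm ⟨m, by lia⟩ (Fin.last _)
  rw [hN.B_eq le_rfl] at h
  have h1 : B (m + 2) ⟨m, by lia⟩ (Fin.last _) = -2 := by simp [B, Fin.ext_iff]
  have h2 : B (m + 2) (Fin.last _) ⟨m, by lia⟩ = -1 := by simp [B, Fin.ext_iff]
  rw [h1, h2] at h
  push_cast at h
  linarith

lemma values_B_zero (m : ℕ) : values (B (m + 2)) (fun _ => 1) 0 = 1 := by
  simp only [values]
  rw [Fin.sum_univ_succ, Fin.sum_univ_succ, Fintype.sum_eq_zero]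
  · simp [B]
  · intro i; simp [B, Fin.ext_iff]

lemma isOneWhite_B (m : ℕ) : IsOneWhite (B (m + 2)) (fun _ => 1) {i | i.val ≠ 0}
    (values (B (m + 2)) fun _ => 1) 0 where
  label_ne := one_ne_zero
  notMem := by simp
  black i _ h := fun h' => h (Fin.ext h')
  val := .inl (values_B_zero m)
  lt h := by rw [values_B_zero] at h; simp at h
  le _ N hN i _ := by
    obtain ⟨k, hk⟩ := i
    rcases (by lia : k ≤ m ∨ k = m + 1) with h | rfl
    · exact (hN.B_eq h).le
    · have := hN.B_last
      have h2 := hN.pos (Fin.last _)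
      change N (Fin.last _) ≤ N 0
      linarith

lemma isTwoWhite_B (m : ℕ) : IsTwoWhite (B (m + 2)) (fun _ => 1)
    {i | i.val ≠ 0 ∧ i.val + 1 ≠ m + 2}
    (values (B (m + 2)) fun _ => 1) 0 (Fin.last (m + 1)) 2 where
  ne := by simp [Fin.ext_iff]
  notMem₁ := by simp
  notMem₂ := by simp
  black i _ h1 h2 := ⟨fun h => h1 (Fin.ext h), fun h => h2 (Fin.ext (Nat.succ.inj h))⟩
  label₁ := .inl rfl
  label₂ := rfl
  one_le := by norm_num
  length N hN := by simpa using hN.B_last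
  val₁ := values_B_zero m
  val₂ := by
    simp only [values]
    rw [Fin.sum_univ_castSucc, Fin.sum_univ_castSucc, Fintype.sum_eq_zero]
    · simp [B, Fin.ext_iff]
    · intro i; simp [B, Fin.ext_iff]; lia
  reach := by
    refine ⟨⟨m, by lia⟩, one_ne_zero, ?_, ?_, ?_, ?_⟩
    · refine isBlackReachable_of_chain (zero_le (a := m)) _ fun k hk _ h => ?_
      refine ⟨by simp; lia, one_ne_zero, ?_⟩
      rw [(B_succ_succ_chain hk h).1]; decide
    · simp [B, Fin.ext_iff]
    · intro _ h i _
      obtain rfl : m = 0 := congrArg Fin.val h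
      fin_cases i <;> simp
    · simp
  long := by simp
  isolated := by simp

lemma C_chain {m k : ℕ} (hk : k + 1 < m + 3) (h : k + 1 ≤ m + 1) :
    C (m + 3) ⟨k, by lia⟩ ⟨k + 1, hk⟩ = -1 ∧ C (m + 3) ⟨k + 1, hk⟩ ⟨k, by lia⟩ = -1 := by
  simp [C]; lia

lemma values_C_one (m : ℕ) : values (C (m + 3))
    (fun i => if i.val = 0 ∨ i.val + 1 = m + 3 then 1 else 2) 1 = 1 := by
  simp only [values]
  rw [Fin.sum_univ_succ, Fin.sum_univ_succ, Fin.sum_univ_succ, Fintype.sum_eq_zero]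
  · cases m with
    | zero => simp [C, Fin.ext_iff]
    | succ m =>
      have : 2 % (m + 1 + 3) = 2 := Nat.mod_eq_of_lt (by lia)
      simp [C, Fin.ext_iff, this]
  · intro i; simp [C, Fin.ext_iff]

lemma isOneWhite_C (m : ℕ) : IsOneWhite (C (m + 3))
    (fun i => if i.val = 0 ∨ i.val + 1 = m + 3 then 1 else 2) {i | i.val ≠ 1}
    (values (C (m + 3)) fun i => if i.val = 0 ∨ i.val + 1 = m + 3 then 1 else 2) 1 where
  label_ne := by simp
  notMem := by simp
  black i _ h := fun h' => h (Fin.ext (by simpa using h'))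
  val := .inl (values_C_one m)
  lt h := by rw [values_C_one] at h; simp at h
  le h := by rw [values_C_one] at h; simp at h

lemma isTwoWhite_C (m : ℕ) : IsTwoWhite (C (m + 3))
    (fun i => if i.val = 0 ∨ i.val + 1 = m + 3 then 1 else 2) {i | i.val ≠ 0 ∧ i.val ≠ 1}
    (values (C (m + 3)) fun i => if i.val = 0 ∨ i.val + 1 = m + 3 then 1 else 2) 1 0 2 where
  ne := by simp
  notMem₁ := by simp
  notMem₂ := by simp
  black i _ h1 h2 := ⟨fun h => h2 (Fin.ext h), fun h => h1 (Fin.ext (by simpa using h))⟩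
  label₁ := .inr (by simp)
  label₂ := by simp
  one_le := by norm_num
  length N hN := by
    have := hN.eq_of_chain (zero_le (a := 1)) (by lia) fun k hk _ h => C_chain hk (by lia)
    change N 1 = N 0 at this
    simp [this]
  val₁ := values_C_one m
  val₂ := by
    simp only [values]
    rw [Fin.sum_univ_succ, Fin.sum_univ_succ, Fintype.sum_eq_zero]
    · simp [C, Fin.ext_iff]
    · intro i
      have : C (m + 3) i.succ.succ 0 = 0 := by
        simp only [C, Matrix.of_apply, Fin.ext_iff, Fin.val_succ, Fin.val_zero]
        grind
      rw [this, mul_zero]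
  reach := by
    refine ⟨1, by simp, .refl _, ?_, ?_, ?_⟩
    · simp [C, Fin.ext_iff]
    · simp
    · simp
  long _ := by
    refine ⟨⟨m + 2, by lia⟩, by simp, ?_, fun N hN => ?_⟩
    · refine isBlackReachable_of_chain (a := 1) (by lia) _ fun k hk h1 _ => ?_
      refine ⟨by simp; lia, by simp only; split_ifs <;> simp, ?_⟩
      simp [C]
    · have h1 := hN.eq_of_chain (a := 1) (b := m + 1) (by lia) (by lia)
        fun k hk _ h => C_chain hk h
      have h2 := hN.mul_comm ⟨m + 1, by lia⟩ ⟨m + 2, by lia⟩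
      have h3 : C (m + 3) ⟨m + 1, by lia⟩ ⟨m + 2, by lia⟩ = -1 := by simp [C]
      have h4 : C (m + 3) ⟨m + 2, by lia⟩ ⟨m + 1, by lia⟩ = -2 := by simp [C]
      rw [h1, h3, h4] at h2
      have h5 := hN.pos 1
      change _ = N 1 * _ at h2
      push_cast at h2
      linarith
  isolated _ i h _ := by
    obtain ⟨h0, h1⟩ := h
    simp only [C, Matrix.of_apply, Fin.ext_iff, Fin.val_zero]
    grind

lemma isOneWhite_F₄ : IsOneWhite F₄ ![1, 2, 3, 2] {i | i ≠ 3} (values F₄ ![1, 2, 3, 2]) 3 where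
  label_ne := by simp
  notMem := by simp
  black i _ h := h
  val := .inl (by decide)
  lt := by decide
  le h := absurd h (by decide)

lemma isOneWhite_G₂ : IsOneWhite G₂ ![1, 2] {0} (values G₂ ![1, 2]) 1 where
  label_ne := by simp
  notMem := by simp
  black i _ h := by simp; lia
  val := .inl (by decide)
  lt := by decide
  le h := absurd h (by decide)

lemma isTwoWhite_G₂ : IsTwoWhite G₂ ![1, 1] ∅ (values G₂ ![1, 1]) 0 1 3 where
  ne := by simp
  notMem₁ := by simp
  notMem₂ := by simp
  black i _ h1 h2 := by lia
  label₁ := .inl rfl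
  label₂ := rfl
  one_le := by norm_num
  length N hN := by
    have := hN.mul_comm 0 1
    simp [G₂] at this ⊢
    linarith
  val₁ := by decide
  val₂ := by decide
  reach := by
    refine ⟨0, by simp, .refl _, by decide, fun _ _ i _ => by lia, by simp⟩
  long := by simp
  isolated := by simp

lemma isOrthogonalPair_D_two : IsOrthogonalPair (D 2) (fun _ => 1) ∅ 0 1 where
  ne := by simp
  notMem₁ := by simp
  notMem₂ := by simp
  support k _ := by lia
  label₁ := rfl
  label₂ := rfl
  pairing := by decide

lemma values_D_zero (m : ℕ) : values (D (m + 3))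
    (fun i => if i.val + 2 < m + 3 then 2 else 1) 0 = 2 := by
  cases m with
  | zero => decide
  | succ m =>
    simp only [values]
    rw [Fin.sum_univ_succ, Fin.sum_univ_succ, Fintype.sum_eq_zero]
    · simp [D, Fin.ext_iff]
    · intro i
      have : D (m + 1 + 3) i.succ.succ 0 = 0 := by
        simp only [D, Matrix.of_apply, Fin.ext_iff, Fin.val_succ, Fin.val_zero]
        grind
      rw [this, mul_zero]

lemma IsLength.D_eq {m : ℕ} {N : Fin (m + 3) → ℝ} (hN : IsLength (D (m + 3)) N)
    (i : Fin (m + 3)) : N i = N 0 := by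
  have h0 (k : ℕ) (hk : k ≤ m) : N ⟨k, by lia⟩ = N 0 :=
    hN.eq_of_chain (zero_le (a := k)) (by lia) fun k hk _ h => by simp [D]; lia
  obtain ⟨k, hk⟩ := i
  by_cases h : k ≤ m
  · exact h0 k h
  · rw [← h0 m le_rfl]
    refine hN.eq_of_eq ?_ ?_
    · exact Matrix.IsSymm.apply (D_isSymm _) _ _
    · simp [D]; lia

lemma isOneWhite_D (m : ℕ) : IsOneWhite (D (m + 3))
    (fun i => if i.val + 2 < m + 3 then 2 else 1) {i | i.val ≠ 0}
    (values (D (m + 3)) fun i => if i.val + 2 < m + 3 then 2 else 1) 0 where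
  label_ne := by simp
  notMem := by simp
  black i _ h := fun h' => h (Fin.ext h')
  val := .inr (values_D_zero m)
  lt h := by rw [values_D_zero] at h; simp at h
  le _ N hN i _ := (hN.D_eq i).le

lemma isOneWhite_B_three : IsOneWhite (B 3) ![1, 2, 3] {i | i ≠ 2} (values (B 3) ![1, 2, 3]) 2 where
  label_ne := by simp
  notMem := by simp
  black i _ h := h
  val := .inr (by decide)
  lt := by decide
  le h := absurd h (by decide)

/-- A label 1 makes the root primitive in the root lattice, which removes proportionality factors.
-/
theorem _root_.IsWeakSphericalDiagram.exists_label_eq_one {n : ℕ} {M : Matrix (Fin n) (Fin n) ℤ}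
    {label : Fin n → ℕ} {black : Set (Fin n)} (h : IsWeakSphericalDiagram M label black) :
    ∃ k, label k = 1 := by
  cases h
  case A_one => exact ⟨0, rfl⟩
  case A hn => exact ⟨⟨0, by lia⟩, rfl⟩
  case B hn => exact ⟨⟨0, by lia⟩, rfl⟩
  case B' hn => exact ⟨⟨0, by lia⟩, rfl⟩
  case C hn => exact ⟨⟨0, by lia⟩, by simp⟩
  case C' hn => exact ⟨⟨0, by lia⟩, by simp⟩
  case D hn => exact ⟨⟨n - 1, by lia⟩, by simp; lia⟩
  all_goals exact ⟨0, rfl⟩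

theorem _root_.IsWeakSphericalDiagram.isTabulated {n : ℕ} {M : Matrix (Fin n) (Fin n) ℤ}
    {label : Fin n → ℕ} {black : Set (Fin n)} (h : IsWeakSphericalDiagram M label black) :
    IsTabulated M label black (values M label) := by
  cases h
  case A_one => exact .inl ⟨_, isOneWhite_A_one⟩
  case A hn =>
    obtain ⟨m, rfl⟩ := Nat.exists_eq_add_of_le' hn
    exact .inr (.inl ⟨_, _, _, isTwoWhite_A m, .inr ⟨_, isTwoWhite_A_rev m⟩⟩)
  case B hn =>
    obtain ⟨m, rfl⟩ := Nat.exists_eq_add_of_le' hn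
    exact .inl ⟨_, isOneWhite_B m⟩
  case B' hn =>
    obtain ⟨m, rfl⟩ := Nat.exists_eq_add_of_le' hn
    exact .inr (.inl ⟨_, _, _, isTwoWhite_B m, .inl (by rw [(isTwoWhite_B m).val₂]; norm_num)⟩)
  case C hn =>
    obtain ⟨m, rfl⟩ := Nat.exists_eq_add_of_le' hn
    exact .inl ⟨_, isOneWhite_C m⟩
  case C' hn =>
    obtain ⟨m, rfl⟩ := Nat.exists_eq_add_of_le' hn
    exact .inr (.inl ⟨_, _, _, isTwoWhite_C m, .inl (by rw [(isTwoWhite_C m).val₂]; norm_num)⟩)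
  case F_four => exact .inl ⟨_, isOneWhite_F₄⟩
  case G_two => exact .inl ⟨_, isOneWhite_G₂⟩
  case G_two' =>
    exact .inr (.inl ⟨_, _, _, isTwoWhite_G₂, .inl (by decide)⟩)
  case D_two => exact .inr (.inr ⟨_, _, isOrthogonalPair_D_two⟩)
  case D hn =>
    obtain ⟨m, rfl⟩ := Nat.exists_eq_add_of_le' hn
    exact .inl ⟨_, isOneWhite_D m⟩
  case B_three => exact .inl ⟨_, isOneWhite_B_three⟩

/-! ### Labelled roots and invariant forms -/

variable {ι : Type v} {Λ : Type u} {Λv : Type w} [AddCommGroup Λ] [AddCommGroup Λv]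

/-- A symmetric form on `Λ` which is invariant under reflections and positive definite on the root
lattice. -/
structure IsInvariantForm (P : RootDatum ι Λ Λv) (B : Λ →ₗ[ℤ] Λ →ₗ[ℤ] ℝ) : Prop where
  symm : ∀ x y, B x y = B y x
  pos : ∀ x ∈ Submodule.span ℤ (Set.range P.root), x ≠ 0 → 0 < B x x
  two_mul : ∀ i χ, 2 * B χ (P.root i) = P.toLinearMap χ (P.coroot i) * B (P.root i) (P.root i)

lemma IsInvariantForm.isLength {P : RootDatum ι Λ Λv} {B : Λ →ₗ[ℤ] Λ →ₗ[ℤ] ℝ}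
    (hB : IsInvariantForm P B) : IsLength P.pairing fun i => B (P.root i) (P.root i) where
  pos i := hB.pos _ (Submodule.subset_span ⟨i, rfl⟩) (P.ne_zero i)
  mul_comm i j := by
    have h1 := hB.two_mul j (P.root i)
    have h2 := hB.two_mul i (P.root j)
    rw [hB.symm (P.root j)] at h2
    rw [P.root_coroot_eq_pairing] at h1 h2
    linear_combination h2 - h1

/-- The values of the coroots on `σ`. -/
abbrev corootValues (P : RootDatum ι Λ Λv) (σ : Λ) (i : ι) : ℤ := P.toLinearMap σ (P.coroot i)

variable [Fintype ι]

/-- `σ` is a weak spherical root with labels `f`, orthogonal to the coroots in `Sp`. -/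
structure IsLabelled (P : RootDatum ι Λ Λv) (b : P.Base) (Sp : Set ι) (σ : Λ) (f : ι → ℕ) :
    Prop where
  support : ∀ i, f i ≠ 0 → i ∈ b.support
  eq_sum : σ = ∑ i, f i • P.root i
  exists_eq_one : ∃ i, f i = 1
  isTabulated : IsTabulated P.pairing f Sp (corootValues P σ)
  orthogonal : ∀ i ∈ Sp, P.toLinearMap σ (P.coroot i) = 0

theorem exists_isLabelled {P : RootDatum ι Λ Λv} {b : P.Base} {Ξ : AddSubgroup Λ} {Sig : Set Λ}
    {Sp : Set ι} (hS : IsWeakSphericalSystem P b Ξ Sig Sp) {σ : Λ} (hσ : σ ∈ Sig) :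
    ∃ f, IsLabelled P b Sp σ f := by
  classical
  obtain ⟨n, C, label, black, e, hd, hsupp, hC, hSp, hsum⟩ := hS.root σ hσ
  have hf (k) : Function.extend e label 0 (e k) = label k := e.injective.extend_apply _ _ k
  have hf0 (j : ι) (hj : Function.extend e label 0 j ≠ 0) : ∃ k, e k = j := by
    by_contra h
    exact hj (Function.extend_apply' _ _ _ h)
  refine ⟨Function.extend e label 0, fun i hi => ?_, ?_, ?_, ?_, ?_⟩
  · obtain ⟨k, rfl⟩ := hf0 i hi
    exact hsupp k
  · rw [hsum, ← Finset.sum_subset (Finset.subset_univ (Finset.univ.map e)), Finset.sum_map]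
    · simp [hf]
    · intro i _ hi
      have : Function.extend e label 0 i = 0 := by
        by_contra h
        obtain ⟨k, rfl⟩ := hf0 i h
        exact hi (by simp)
      rw [this, zero_smul]
  · obtain ⟨k, hk⟩ := hd.exists_label_eq_one
    exact ⟨e k, by rw [hf, hk]⟩
  · refine hd.isTabulated.map e hC hf hf0 hSp fun k => ?_
    simp [corootValues, hsum, values, hC]
  · exact fun i hi => hS.orthogonal i hi σ (hS.subset_lattice hσ)

namespace IsLabelled

variable {P : RootDatum ι Λ Λv} {b : P.Base} {Sp : Set ι} {σ τ : Λ} {f g : ι → ℕ}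

lemma apply_coroot (h : IsLabelled P b Sp σ f) (j : ι) :
    P.toLinearMap σ (P.coroot j) = ∑ i, f i * P.pairing i j := by
  rw [h.eq_sum]; simp

lemma mem_span (h : IsLabelled P b Sp σ f) : σ ∈ Submodule.span ℤ (Set.range P.root) := by
  rw [h.eq_sum]
  exact Submodule.sum_mem _ fun i _ =>
    Submodule.smul_of_tower_mem _ _ (Submodule.subset_span ⟨i, rfl⟩)

lemma pairing_nonpos (b : P.Base) {i j : ι} (hi : i ∈ b.support) (hj : j ∈ b.support) (hij : i ≠ j) :
    P.pairing i j ≤ 0 := by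
  have := b.pairingIn_le_zero_of_ne hij hi hj
  rwa [← P.algebraMap_pairingIn ℤ i j]

lemma term_nonpos (h : IsLabelled P b Sp σ f) {j : ι} (hj : j ∈ b.support) (hf : f j = 0) (i : ι) :
    f i * P.pairing i j ≤ 0 := by
  by_cases hi : f i = 0
  · simp [hi]
  · exact mul_nonpos_of_nonneg_of_nonpos (by positivity)
      (pairing_nonpos b (h.support i hi) hj fun h => hi (h ▸ hf))

/-- Off the support all terms of the sum are nonpositive, so any single one is an upper bound. -/
lemma apply_coroot_le (h : IsLabelled P b Sp σ f) {j : ι} (hj : j ∈ b.support) (hf : f j = 0)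
    (d : ι) : P.toLinearMap σ (P.coroot j) ≤ f d * P.pairing d j := by
  classical
  rw [h.apply_coroot, ← Finset.add_sum_erase _ _ (Finset.mem_univ d)]
  have := Finset.sum_nonpos (s := Finset.univ.erase d) fun i _ => h.term_nonpos hj hf i
  linarith

lemma apply_coroot_nonpos (h : IsLabelled P b Sp σ f) {j : ι} (hj : j ∈ b.support) (hf : f j = 0) :
    P.toLinearMap σ (P.coroot j) ≤ 0 := by
  simpa [hf] using h.apply_coroot_le hj hf j

/-- A black vertex adjacent to the support but outside it would have a coroot strictly negative on
σ, against orthogonality. -/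
lemma ne_zero_of_black (h : IsLabelled P b Sp σ f) (hSp : Sp ⊆ b.support) {k l : ι}
    (hk : f k ≠ 0) (hl : l ∈ Sp) (hkl : P.pairing k l ≠ 0) : f l ≠ 0 := by
  intro hf
  have h1 := h.apply_coroot_le (hSp hl) hf k
  have h2 := h.term_nonpos (hSp hl) hf k
  rw [h.orthogonal l hl] at h1
  exact mul_ne_zero (by exact_mod_cast hk) hkl (le_antisymm h2 h1)

lemma ne_zero_of_reachable (h : IsLabelled P b Sp σ f) (hSp : Sp ⊆ b.support) {k d : ι}
    (hk : f k ≠ 0) (hd : IsBlackReachable P.pairing g Sp k d) : f d ≠ 0 :=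
  hd {k | f k ≠ 0} hk fun _ hk _ hl _ hkl => h.ne_zero_of_black hSp hk hl hkl

variable {B : Λ →ₗ[ℤ] Λ →ₗ[ℤ] ℝ}

lemma two_mul_form (h : IsLabelled P b Sp σ f) (hB : IsInvariantForm P B) (χ : Λ) :
    2 * B χ σ = ∑ i, f i * B (P.root i) (P.root i) * P.toLinearMap χ (P.coroot i) := by
  conv_lhs => rw [h.eq_sum]
  rw [map_sum, Finset.mul_sum]
  refine Finset.sum_congr rfl fun i _ => ?_
  rw [map_nsmul, nsmul_eq_mul]
  linear_combination (f i : ℝ) * hB.two_mul i χ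

lemma two_mul_form_of_isOneWhite (h : IsLabelled P b Sp σ f) (hB : IsInvariantForm P B) {v : ι → ℤ}
    {w : ι} (hw : IsOneWhite P.pairing f Sp v w) {χ : Λ}
    (hχ : ∀ i ∈ Sp, P.toLinearMap χ (P.coroot i) = 0) :
    2 * B χ σ = f w * B (P.root w) (P.root w) * P.toLinearMap χ (P.coroot w) := by
  rw [h.two_mul_form hB, Fintype.sum_eq_single w]
  intro i hi
  by_cases h0 : f i = 0
  · simp [h0]
  · simp [hχ i (hw.black i h0 hi)]

lemma two_mul_form_of_isTwoWhite (h : IsLabelled P b Sp σ f) (hB : IsInvariantForm P B) {v : ι → ℤ}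
    {w₁ w₂ : ι} {r : ℤ} (hw : IsTwoWhite P.pairing f Sp v w₁ w₂ r) {χ : Λ}
    (hχ : ∀ i ∈ Sp, P.toLinearMap χ (P.coroot i) = 0) :
    2 * B χ σ = f w₁ * B (P.root w₁) (P.root w₁) * P.toLinearMap χ (P.coroot w₁) +
      B (P.root w₂) (P.root w₂) * P.toLinearMap χ (P.coroot w₂) := by
  rw [h.two_mul_form hB, Fintype.sum_eq_add w₁ w₂ hw.ne, hw.label₂, Nat.cast_one, one_mul]
  rintro i ⟨h1, h2⟩
  by_cases h0 : f i = 0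
  · simp [h0]
  · simp [hχ i (hw.black i h0 h1 h2)]

lemma two_mul_form_of_isOrthogonalPair (h : IsLabelled P b Sp σ f) (hB : IsInvariantForm P B)
    {i j : ι} (hij : IsOrthogonalPair P.pairing f Sp i j) {χ : Λ}
    (hχ : P.toLinearMap χ (P.coroot i) = P.toLinearMap χ (P.coroot j)) :
    2 * B χ σ = (B (P.root i) (P.root i) + B (P.root j) (P.root j)) *
      P.toLinearMap χ (P.coroot i) := by
  rw [h.two_mul_form hB, Fintype.sum_eq_add i j hij.ne, hij.label₁, hij.label₂, ← hχ]
  · push_cast; ring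
  · rintro k ⟨h1, h2⟩
    have : f k = 0 := by
      by_contra h0
      exact (hij.support k h0).elim h1 h2
    simp [this]

/-- Two weak spherical roots whose labels are proportional on the white vertices are equal. -/
lemma eq_of_proportional (hf : IsLabelled P b Sp σ f) (hg : IsLabelled P b Sp τ g)
    (hB : IsInvariantForm P B) (p q : ℕ) (hp : p ≠ 0)
    (h : ∀ i ∉ Sp, p * f i = q * g i) : σ = τ := by
  classical
  have hx : (p : ℤ) • σ - (q : ℤ) • τ = ∑ i, ((p * f i : ℤ) - q * g i) • P.root i := by
    simp only [sub_smul, Finset.sum_sub_distrib, mul_smul, ← Finset.smul_sum]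
    rw [hf.eq_sum, hg.eq_sum]
    simp
  have horth : ∀ i ∈ Sp, P.toLinearMap ((p : ℤ) • σ - (q : ℤ) • τ) (P.coroot i) = 0 := by
    intro i hi
    simp [hf.orthogonal i hi, hg.orthogonal i hi]
  have hmem : (p : ℤ) • σ - (q : ℤ) • τ ∈ Submodule.span ℤ (Set.range P.root) :=
    Submodule.sub_mem _ (Submodule.smul_mem _ _ hf.mem_span) (Submodule.smul_mem _ _ hg.mem_span)
  have hx0 : (p : ℤ) • σ - (q : ℤ) • τ = 0 := by
    by_contra hne
    refine (hB.pos _ hmem hne).ne' ?_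
    generalize (p : ℤ) • σ - (q : ℤ) • τ = x at hx horth
    -- The vector x combines only black simple roots and is orthogonal to the black coroots, hence
    -- to itself.
    have : 2 * B x x = 0 := by
      conv_lhs => rw [congrArg (B x) hx]
      rw [map_sum, Finset.mul_sum]
      refine Finset.sum_eq_zero fun i _ => ?_
      rw [map_smul, zsmul_eq_mul]
      by_cases hi : i ∈ Sp
      · have h2 := hB.two_mul i x
        rw [horth i hi] at h2
        push_cast at h2 ⊢
        linear_combination ((p * f i : ℝ) - q * g i) * h2
      · have : (p * f i : ℤ) - q * g i = 0 := by rw [sub_eq_zero]; exact_mod_cast h i hi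
        rw [this]; simp
    linarith
  have hall (i : ι) : p * f i = q * g i := by
    by_cases hi : i ∈ b.support
    · rw [hx] at hx0
      rw [← Finset.sum_subset (Finset.subset_univ b.support)] at hx0
      · have := linearIndepOn_iff'.mp b.linearIndepOn_root b.support _ subset_rfl hx0 i hi
        exact_mod_cast sub_eq_zero.mp this
      · intro i _ hi
        have h1 : f i = 0 := by_contra fun h => hi (hf.support i h)
        have h2 : g i = 0 := by_contra fun h => hi (hg.support i h)
        simp [h1, h2]
    · have h1 : f i = 0 := by_contra fun h => hi (hf.support i h)
      have h2 : g i = 0 := by_contra fun h => hi (hg.support i h)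
      simp [h1, h2]
  obtain ⟨i, hi⟩ := hf.exists_eq_one
  obtain ⟨j, hj⟩ := hg.exists_eq_one
  have h1 := hall i
  have h2 := hall j
  rw [hi] at h1
  rw [hj] at h2
  -- A label 1 on each side makes p and q divide each other.
  have hpq : p = q := Nat.dvd_antisymm ⟨f j, by lia⟩ ⟨g i, by lia⟩
  rw [hf.eq_sum, hg.eq_sum]
  refine Finset.sum_congr rfl fun k _ => ?_
  rw [Nat.eq_of_mul_eq_mul_left (Nat.pos_of_ne_zero hp) ((hall k).trans (by rw [hpq]))]

end IsLabelled

/-! ### Angles between two weak spherical roots -/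

variable {ι : Type v} {Λ : Type u} {Λv : Type w} [AddCommGroup Λ] [AddCommGroup Λv] [Fintype ι]

namespace IsLabelled

variable {P : RootDatum ι Λ Λv} {b : P.Base} {Sp : Set ι} {σ τ : Λ} {f g : ι → ℕ}
  {B : Λ →ₗ[ℤ] Λ →ₗ[ℤ] ℝ}

lemma form_nonpos_of_isOneWhite (hB : IsInvariantForm P B) (hf : IsLabelled P b Sp σ f)
    {v : ι → ℤ} {w : ι} (hw : IsOneWhite P.pairing f Sp v w) {χ : Λ}
    (hχ : ∀ i ∈ Sp, P.toLinearMap χ (P.coroot i) = 0) (h : P.toLinearMap χ (P.coroot w) ≤ 0) :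
    B χ σ ≤ 0 := by
  have h1 := hf.two_mul_form_of_isOneWhite hB hw hχ
  have h2 := hB.isLength.pos w
  have h3 : (P.toLinearMap χ (P.coroot w) : ℝ) ≤ 0 := by exact_mod_cast h
  have h4 : (f w : ℝ) * B (P.root w) (P.root w) * P.toLinearMap χ (P.coroot w) ≤ 0 :=
    mul_nonpos_of_nonneg_of_nonpos (by positivity) h3
  linarith

lemma form_nonpos_of_isTwoWhite (hB : IsInvariantForm P B) (hf : IsLabelled P b Sp σ f)
    {v : ι → ℤ} {w₁ w₂ : ι} {r : ℤ} (hw : IsTwoWhite P.pairing f Sp v w₁ w₂ r) {χ : Λ}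
    (hχ : ∀ i ∈ Sp, P.toLinearMap χ (P.coroot i) = 0) (h₁ : P.toLinearMap χ (P.coroot w₁) ≤ 0)
    (h₂ : P.toLinearMap χ (P.coroot w₂) ≤ 0) : B χ σ ≤ 0 := by
  have h1 := hf.two_mul_form_of_isTwoWhite hB hw hχ
  have h2 := hB.isLength.pos w₁
  have h2' := hB.isLength.pos w₂
  have h3 : (P.toLinearMap χ (P.coroot w₁) : ℝ) ≤ 0 := by exact_mod_cast h₁
  have h3' : (P.toLinearMap χ (P.coroot w₂) : ℝ) ≤ 0 := by exact_mod_cast h₂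
  have h4 : (f w₁ : ℝ) * B (P.root w₁) (P.root w₁) * P.toLinearMap χ (P.coroot w₁) ≤ 0 :=
    mul_nonpos_of_nonneg_of_nonpos (by positivity) h3
  have h4' := mul_nonpos_of_nonneg_of_nonpos h2'.le h3'
  linarith

variable (hB : IsInvariantForm P B) (hSp : Sp ⊆ b.support) (hf : IsLabelled P b Sp σ f)
  (hg : IsLabelled P b Sp τ g)

include hB hf hg

lemma form_nonpos_of_isOneWhite_of_isOneWhite (hne : σ ≠ τ) {w x : ι}
    (hw : IsOneWhite P.pairing f Sp (corootValues P σ) w) (hx : IsOneWhite P.pairing g Sp (corootValues P τ) x) :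
    B σ τ ≤ 0 := by
  by_cases hwx : w = x
  · subst hwx
    refine absurd (hf.eq_of_proportional hg hB (g w) (f w) hx.label_ne fun i hi => ?_) hne
    by_cases hiw : i = w
    · subst hiw; ring
    · have h1 : f i = 0 := by_contra fun h => hi (hw.black i h hiw)
      have h2 : g i = 0 := by_contra fun h => hi (hx.black i h hiw)
      simp [h1, h2]
  · have h1 : f x = 0 := by_contra fun h => hx.notMem (hw.black x h (Ne.symm hwx))
    exact hg.form_nonpos_of_isOneWhite hB hx hf.orthogonal
      (hf.apply_coroot_nonpos (hg.support x hx.label_ne) h1)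

include hSp in
lemma false_of_isOneWhite_of_isTwoWhite {w x : ι} {r : ℤ}
    (hw : IsOneWhite P.pairing f Sp (corootValues P σ) w) (hx : IsTwoWhite P.pairing g Sp (corootValues P τ) w x r)
    (hA : σ = P.root w → τ = P.root w + P.root x → P.pairing x w ≠ -1) : False := by
  have hgx : g x ≠ 0 := by rw [hx.label₂]; exact one_ne_zero
  have hfx : f x = 0 := by_contra fun h => hx.notMem₂ (hw.black x h hx.ne.symm)
  obtain ⟨d, -, hd, hdr, h₁, h₂⟩ := hx.reach
  have hfd : f d ≠ 0 := hf.ne_zero_of_reachable hSp hw.label_ne hd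
  have hle := hf.apply_coroot_le (hg.support x hgx) hfx d
  have e1 := hg.two_mul_form_of_isTwoWhite hB hx hf.orthogonal
  have e2 := hf.two_mul_form_of_isOneWhite hB hw hg.orthogonal
  have hv₁ : P.toLinearMap τ (P.coroot w) = 1 := hx.val₁
  have hlen := hx.length _ hB.isLength
  have hNw := hB.isLength.pos w
  have hNx := hB.isLength.pos x
  rw [hv₁, hB.symm] at e2
  -- Evaluate 2(σ,τ) both ways: it is f_w N_w, and also g_w N_w ⟨σ, w^∨⟩ + N_x ⟨σ, x^∨⟩. The last
  -- term is at most -f_d N_w, by the choice of `d` and the length relation.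
  have key : (f w : ℤ) ≤ g w * P.toLinearMap σ (P.coroot w) - f d := by
    have h3 : (g w : ℤ) * P.toLinearMap σ (P.coroot x) ≤ - (f d * r) := by
      have := mul_le_mul_of_nonneg_left hle (by positivity : (0 : ℤ) ≤ g w)
      linear_combination this + f d * hdr
    have h4 : (g w : ℝ) * P.toLinearMap σ (P.coroot x) ≤ - (f d * r) := by exact_mod_cast h3
    have hgw : 0 < (g w : ℝ) := by rcases hx.label₁ with h | h <;> rw [h] <;> norm_num
    have h5 : B (P.root x) (P.root x) * P.toLinearMap σ (P.coroot x) ≤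
        -(f d * B (P.root w) (P.root w)) := by
      refine le_of_mul_le_mul_left ?_ hgw
      have := mul_le_mul_of_nonneg_left h4 hNx.le
      linear_combination this + f d * hlen
    have h6 : (f w : ℝ) * B (P.root w) (P.root w) ≤
        (g w * P.toLinearMap σ (P.coroot w) - f d) * B (P.root w) (P.root w) := by
      push_cast at e2
      linear_combination h5 + e1 - e2
    exact_mod_cast le_of_mul_le_mul_right h6 hNw
  have hfd1 : 1 ≤ f d := Nat.one_le_iff_ne_zero.mpr hfd
  rcases hx.label₁ with hgw | hgw
  · rw [hgw] at key
    -- This leaves σ = α_w and τ = α_w + α_x, the configuration forbidden by condition 4.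
    have hlt : (f w : ℤ) < P.toLinearMap σ (P.coroot w) := by push_cast at key; lia
    have hsupp := hw.lt hlt
    have hdw := hsupp d hfd
    have hsupp' := h₁ hgw hdw
    have hfw : f w = 1 := by
      obtain ⟨i, hi⟩ := hf.exists_eq_one
      rwa [hsupp i (by rw [hi]; exact one_ne_zero)] at hi
    have hσ : σ = P.root w := by
      rw [hf.eq_sum, Fintype.sum_eq_single w, hfw, one_smul]
      intro i hi
      have : f i = 0 := by_contra fun h => hi (hsupp i h)
      rw [this, zero_smul]
    have hτ : τ = P.root w + P.root x := by
      rw [hg.eq_sum, Fintype.sum_eq_add w x hx.ne, hgw, hx.label₂, one_smul, one_smul]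
      rintro i ⟨hi, hi'⟩
      have : g i = 0 := by_contra fun h => (hsupp' i h).elim hi hi'
      rw [this, zero_smul]
    refine hA hσ hτ ?_
    rw [hτ] at hv₁
    simp only [map_add, LinearMap.add_apply, P.root_coroot_eq_pairing, P.pairing_same] at hv₁
    lia
  · have hdw := h₂ hgw
    rw [hgw, hdw] at key
    -- Now w should be longest in the support of σ, but that support contains the long end of the Cₙ
    -- diagram of τ.
    have hle : (f w : ℤ) ≤ P.toLinearMap σ (P.coroot w) := by push_cast at key; lia
    obtain ⟨l, -, hl, hlN⟩ := hx.long hgw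
    exact (hlN _ hB.isLength).not_ge
      (hw.le hle _ hB.isLength l (hf.ne_zero_of_reachable hSp hw.label_ne hl))

include hSp in
lemma form_nonpos_of_isOneWhite_of_isTwoWhite {w x y : ι} {r : ℤ}
    (hw : IsOneWhite P.pairing f Sp (corootValues P σ) w) (hx : IsTwoWhite P.pairing g Sp (corootValues P τ) x y r)
    (hxy : (corootValues P τ) y ≤ 0 ∨ ∃ r', IsTwoWhite P.pairing g Sp (corootValues P τ) y x r')
    (hA : ∀ i ∈ b.support, ∀ j ∈ b.support, σ = P.root i → τ = P.root i + P.root j →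
      P.pairing j i ≠ -1) : B σ τ ≤ 0 := by
  have hxs : x ∈ b.support := hg.support x (by rcases hx.label₁ with h | h <;> rw [h] <;> norm_num)
  have hys : y ∈ b.support := hg.support y (by rw [hx.label₂]; norm_num)
  rw [hB.symm]
  refine hf.form_nonpos_of_isOneWhite hB hw hg.orthogonal ?_
  by_cases hwx : w = x
  · subst hwx
    exact (hf.false_of_isOneWhite_of_isTwoWhite hB hSp hg hw hx (hA _ hxs _ hys)).elim
  by_cases hwy : w = y
  · subst hwy
    rcases hxy with h | ⟨r', hx'⟩
    · exact h
    · exact (hf.false_of_isOneWhite_of_isTwoWhite hB hSp hg hw hx' (hA _ hys _ hxs)).elim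
  · exact hg.apply_coroot_nonpos (hf.support w hw.label_ne)
      (by_contra fun h => hw.notMem (hx.black w h hwx hwy))

lemma form_nonpos_of_isOrthogonalPair (hne : σ ≠ τ) {i j : ι}
    (hij : IsOrthogonalPair P.pairing g Sp i j)
    (hσ : P.toLinearMap σ (P.coroot i) = P.toLinearMap σ (P.coroot j)) : B σ τ ≤ 0 := by
  suffices P.toLinearMap σ (P.coroot i) ≤ 0 by
    have h1 := hg.two_mul_form_of_isOrthogonalPair hB hij hσ
    have h2 := hB.isLength.pos i
    have h3 := hB.isLength.pos j
    have h4 : (P.toLinearMap σ (P.coroot i) : ℝ) ≤ 0 := by exact_mod_cast this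
    have h5 := mul_nonpos_of_nonneg_of_nonpos (add_pos h2 h3).le h4
    linarith
  have his : i ∈ b.support := hg.support i (by rw [hij.label₁]; exact one_ne_zero)
  have hjs : j ∈ b.support := hg.support j (by rw [hij.label₂]; exact one_ne_zero)
  by_cases hi : f i = 0
  · exact hf.apply_coroot_nonpos his hi
  by_cases hj : f j = 0
  · rw [hσ]; exact hf.apply_coroot_nonpos hjs hj
  -- If i and j both lie in the support of σ, they are exactly its white vertices. Labels 1 then
  -- give σ = τ, while label 2 would make i and j adjacent.
  have heq (h1 : f i = 1) (h2 : f j = 1) (h3 : ∀ k ∉ Sp, k ≠ i → k ≠ j → f k = 0) : σ = τ := by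
    refine hf.eq_of_proportional hg hB 1 1 one_ne_zero fun k hk => ?_
    by_cases hki : k = i
    · rw [hki, h1, hij.label₁]
    by_cases hkj : k = j
    · rw [hkj, h2, hij.label₂]
    have : g k = 0 := by_contra fun h => (hij.support k h).elim hki hkj
    rw [h3 k hk hki hkj, this]
  rcases hf.isTabulated with ⟨w, hw⟩ | ⟨w, x, r, hw, -⟩ | ⟨w, x, hw⟩
  · have h1 : i = w := by_contra fun h => hij.notMem₁ (hw.black i hi h)
    have h2 : j = w := by_contra fun h => hij.notMem₂ (hw.black j hj h)
    exact absurd (h1.trans h2.symm) hij.ne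
  · have hiw : i = w ∨ i = x := by
      by_contra! h; exact hij.notMem₁ (hw.black i hi h.1 h.2)
    have hjw : j = w ∨ j = x := by
      by_contra! h; exact hij.notMem₂ (hw.black j hj h.1 h.2)
    rcases hw.label₁ with h1 | h1
    · refine absurd (heq ?_ ?_ fun k hk hki hkj => ?_) hne
      · rcases hiw with h | h <;> rw [h]
        exacts [h1, hw.label₂]
      · rcases hjw with h | h <;> rw [h]
        exacts [h1, hw.label₂]
      · by_contra h
        refine hk (hw.black k h ?_ ?_) <;> rintro rfl
        · rcases hiw with h | h
          · exact hki h.symm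
          · rcases hjw with h' | h'
            · exact hkj h'.symm
            · exact hij.ne (h.trans h'.symm)
        · rcases hiw with h | h
          · rcases hjw with h' | h'
            · exact hij.ne (h.trans h'.symm)
            · exact hkj h'.symm
          · exact hki h.symm
    · obtain ⟨d, -, -, hd, -, hdw⟩ := hw.reach
      have hwx : P.pairing w x ≠ 0 := by
        rintro h
        rw [hdw h1, h] at hd
        have := hw.one_le
        lia
      have hxw : P.pairing x w ≠ 0 := by
        intro h
        have := hB.isLength.mul_comm w x
        rw [h, Int.cast_zero, mul_zero, mul_eq_zero] at this
        rcases this with h | h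
        · exact (hB.isLength.pos x).ne' h
        · exact hwx (by exact_mod_cast h)
      have h0 := hij.pairing
      rcases hiw with h | h <;> rcases hjw with h' | h'
      · exact absurd (h.trans h'.symm) hij.ne
      · rw [h, h'] at h0; exact absurd h0 hwx
      · rw [h, h'] at h0; exact absurd h0 hxw
      · exact absurd (h.trans h'.symm) hij.ne
  · refine absurd (heq ?_ ?_ fun k hk hki hkj => ?_) hne
    · rcases hw.support i hi with h | h <;> rw [h]
      exacts [hw.label₁, hw.label₂]
    · rcases hw.support j hj with h | h <;> rw [h]
      exacts [hw.label₁, hw.label₂]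
    · by_contra h
      have h1 := hw.support i hi
      have h2 := hw.support j hj
      have h3 := hw.support k h
      have h4 := hij.ne
      grind

/-- The two evaluations of 2(σ,τ) are (r + 2 - s) N_x and (s + 2 - r) N_x. So r = s, the white
labels agree and σ = τ. -/
lemma false_of_isTwoWhite_of_eq (hne : σ ≠ τ) {w x : ι} {r s : ℤ}
    (hw : IsTwoWhite P.pairing f Sp (corootValues P σ) w x r)
    (hx : IsTwoWhite P.pairing g Sp (corootValues P τ) w x s) : False := by
  have e1 := hf.two_mul_form_of_isTwoWhite hB hw hg.orthogonal
  have e2 := hg.two_mul_form_of_isTwoWhite hB hx hf.orthogonal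
  have v1 : P.toLinearMap σ (P.coroot w) = 1 := hw.val₁
  have v2 : P.toLinearMap σ (P.coroot x) = 2 - r := hw.val₂
  have v3 : P.toLinearMap τ (P.coroot w) = 1 := hx.val₁
  have v4 : P.toLinearMap τ (P.coroot x) = 2 - s := hx.val₂
  have l1 := hw.length _ hB.isLength
  have l2 := hx.length _ hB.isLength
  have hNw := hB.isLength.pos w
  have hNx := hB.isLength.pos x
  rw [hB.symm, v3, v4] at e1
  rw [v1, v2] at e2
  push_cast at e1 e2
  have hrs : (r : ℝ) = s := by
    have : (r - s : ℝ) * B (P.root x) (P.root x) = 0 := by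
      linear_combination (e2 - e1 - l1 + l2) / 2
    rcases mul_eq_zero.mp this with h | h
    · exact sub_eq_zero.mp h
    · exact absurd h hNx.ne'
  have hfg : f w = g w := by
    rw [hrs, ← l2] at l1
    exact_mod_cast mul_right_cancel₀ hNw.ne' l1
  refine hne (hf.eq_of_proportional hg hB 1 1 one_ne_zero fun i hi => ?_)
  by_cases h1 : i = w
  · rw [h1, hfg]
  by_cases h2 : i = x
  · rw [h2, hw.label₂, hx.label₂]
  have h3 : f i = 0 := by_contra fun h => hi (hw.black i h h1 h2)
  have h4 : g i = 0 := by_contra fun h => hi (hx.black i h h1 h2)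
  rw [h3, h4]

/-- With g_x = 1 the lengths give rs = 2, and the two evaluations of 2(σ,τ) become (4 - s) N_w and
(2s - 1) N_w, which differ for s = 1, 2. -/
lemma label_ne_of_isTwoWhite_swap {w x : ι} {r s : ℤ}
    (hw : IsTwoWhite P.pairing f Sp (corootValues P σ) w x r)
    (hx : IsTwoWhite P.pairing g Sp (corootValues P τ) x w s) (hf2 : f w = 2) : g x ≠ 1 := by
  intro hg1
  have e1 := hf.two_mul_form_of_isTwoWhite hB hw hg.orthogonal
  have e2 := hg.two_mul_form_of_isTwoWhite hB hx hf.orthogonal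
  have v1 : P.toLinearMap σ (P.coroot w) = 1 := hw.val₁
  have v2 : P.toLinearMap σ (P.coroot x) = 2 - r := hw.val₂
  have v3 : P.toLinearMap τ (P.coroot x) = 1 := hx.val₁
  have v4 : P.toLinearMap τ (P.coroot w) = 2 - s := hx.val₂
  have l1 := hw.length _ hB.isLength
  have l2 := hx.length _ hB.isLength
  have hNw := hB.isLength.pos w
  rw [hB.symm, v3, v4] at e1
  rw [v1, v2] at e2
  simp only [hf2, hg1] at l1 l2
  rw [hf2] at e1
  rw [hg1] at e2
  push_cast at e1 e2 l1 l2
  have hrs : r * s = 2 := by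
    have : ((r * s : ℤ) : ℝ) * B (P.root w) (P.root w) = 2 * B (P.root w) (P.root w) := by
      push_cast
      linear_combination -l1 - r * l2
    exact_mod_cast mul_right_cancel₀ hNw.ne' this
  have hr := hw.one_le
  have hs := hx.one_le
  have hs2 : s ≤ 2 := by nlinarith
  obtain rfl | rfl : s = 1 ∨ s = 2 := by lia
  · obtain rfl : r = 2 := by lia
    push_cast at *
    linarith
  · obtain rfl : r = 1 := by lia
    push_cast at *
    linarith

include hSp in
lemma false_of_isTwoWhite_swap (hne : σ ≠ τ) {w x : ι} {r s : ℤ}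
    (hw : IsTwoWhite P.pairing f Sp (corootValues P σ) w x r)
    (hx : IsTwoWhite P.pairing g Sp (corootValues P τ) x w s) : False := by
  rcases hw.label₁ with hf1 | hf2 <;> rcases hx.label₁ with hg1 | hg2
  · refine hne (hf.eq_of_proportional hg hB 1 1 one_ne_zero fun i hi => ?_)
    by_cases h1 : i = w
    · rw [h1, hf1, hx.label₂]
    by_cases h2 : i = x
    · rw [h2, hw.label₂, hg1]
    have h3 : f i = 0 := by_contra fun h => hi (hw.black i h h1 h2)
    have h4 : g i = 0 := by_contra fun h => hi (hx.black i h h2 h1)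
    rw [h3, h4]
  · exact hg.label_ne_of_isTwoWhite_swap hB hf hx hw hg2 hf1
  · exact hf.label_ne_of_isTwoWhite_swap hB hg hw hx hf2 hg1
  · obtain ⟨l, -, hl, hN⟩ := hw.long hf2
    -- Black neighbours of w lie in the support of τ, where `isolated` forbids them. No black path
    -- leaves w, so the long vertex would be w itself.
    have hlw : l = w := by
      refine hl {w} rfl ?_
      rintro k (hk : k = w) l hl hfl hwl
      rw [hk] at hwl
      have hgl := hg.ne_zero_of_black hSp (by rw [hx.label₂]; exact one_ne_zero) hl hwl
      have h0 := hx.isolated hg2 l hl hgl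
      have := hB.isLength.mul_comm w l
      rw [h0, Int.cast_zero, mul_zero, mul_eq_zero] at this
      rcases this with h | h
      · exact absurd h (hB.isLength.pos l).ne'
      · exact absurd (by exact_mod_cast h) hwl
    have := hN _ hB.isLength
    rw [hlw] at this
    exact lt_irrefl _ this

include hSp in
-- The support of σ reaches the neighbour `d` of y with label at least g_w, so ⟨σ, y^∨⟩ ≤ -s. This
-- cancels the contribution g_w N_w = s N_y of w.
lemma form_nonpos_of_isTwoWhite_of_label {w x y : ι} {r s : ℤ}
    (hw : IsTwoWhite P.pairing f Sp (corootValues P σ) w x r)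
    (hx : IsTwoWhite P.pairing g Sp (corootValues P τ) w y s) (hxy : x ≠ y) (hfg : g w ≤ f w) :
    B σ τ ≤ 0 := by
  have hfw : f w ≠ 0 := by rcases hw.label₁ with h | h <;> rw [h] <;> norm_num
  have hfy : f y = 0 := by_contra fun h => hx.notMem₂ (hw.black y h hx.ne.symm hxy.symm)
  have hys : y ∈ b.support := hg.support y (by rw [hx.label₂]; norm_num)
  obtain ⟨d, -, hd, hdr, -, h₂⟩ := hx.reach
  have hfd : f d ≠ 0 := hf.ne_zero_of_reachable hSp hfw hd
  have hgd : g w ≤ f d := by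
    rcases hx.label₁ with h | h
    · rw [h]; exact Nat.one_le_iff_ne_zero.mpr hfd
    · rw [h₂ h]; exact hfg
  have hle := hf.apply_coroot_le hys hfy d
  have hpd : P.pairing d y ≤ 0 := by
    refine pairing_nonpos b (hf.support d hfd) hys fun h => hfd (h ▸ hfy)
  have hle' : P.toLinearMap σ (P.coroot y) ≤ -s := by
    have : (f d : ℤ) * P.pairing d y ≤ g w * P.pairing d y :=
      mul_le_mul_of_nonpos_right (by exact_mod_cast hgd) hpd
    lia
  have e2 := hg.two_mul_form_of_isTwoWhite hB hx hf.orthogonal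
  have v1 : P.toLinearMap σ (P.coroot w) = 1 := hw.val₁
  have l2 := hx.length _ hB.isLength
  have hNy := hB.isLength.pos y
  rw [v1] at e2
  have h3 : (P.toLinearMap σ (P.coroot y) : ℝ) ≤ -s := by exact_mod_cast hle'
  have h4 := mul_le_mul_of_nonneg_left h3 hNy.le
  push_cast at e2
  linarith

include hSp in
lemma form_nonpos_of_isTwoWhite_of_ne {w x y : ι} {r s : ℤ}
    (hw : IsTwoWhite P.pairing f Sp (corootValues P σ) w x r)
    (hx : IsTwoWhite P.pairing g Sp (corootValues P τ) w y s) (hxy : x ≠ y) : B σ τ ≤ 0 := by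
  rcases le_total (g w) (f w) with h | h
  · exact hf.form_nonpos_of_isTwoWhite_of_label hB hSp hg hw hx hxy h
  · rw [hB.symm]
    exact hg.form_nonpos_of_isTwoWhite_of_label hB hSp hf hx hw hxy.symm h

include hSp in
lemma form_nonpos_of_isTwoWhite_of_isTwoWhite (hne : σ ≠ τ) {w x y z : ι} {r s : ℤ}
    (hw : IsTwoWhite P.pairing f Sp (corootValues P σ) w x r)
    (hw' : (corootValues P σ) x ≤ 0 ∨ ∃ r', IsTwoWhite P.pairing f Sp (corootValues P σ) x w r')
    (hy : IsTwoWhite P.pairing g Sp (corootValues P τ) y z s)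
    (hy' : (corootValues P τ) z ≤ 0 ∨ ∃ s', IsTwoWhite P.pairing g Sp (corootValues P τ) z y s') :
    B σ τ ≤ 0 := by
  have f_zero {i : ι} (h1 : i ≠ w) (h2 : i ≠ x) (h3 : i ∉ Sp) : f i = 0 :=
    by_contra fun h => h3 (hw.black i h h1 h2)
  have g_zero {i : ι} (h1 : i ≠ y) (h2 : i ≠ z) (h3 : i ∉ Sp) : g i = 0 :=
    by_contra fun h => h3 (hy.black i h h1 h2)
  have hws : w ∈ b.support := hf.support w (by rcases hw.label₁ with h | h <;> rw [h] <;> norm_num)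
  have hxs : x ∈ b.support := hf.support x (by rw [hw.label₂]; norm_num)
  have hys : y ∈ b.support := hg.support y (by rcases hy.label₁ with h | h <;> rw [h] <;> norm_num)
  have hzs : z ∈ b.support := hg.support z (by rw [hy.label₂]; norm_num)
  have left (h1 : (corootValues P τ) w ≤ 0) (h2 : (corootValues P τ) x ≤ 0) : B σ τ ≤ 0 := by
    rw [hB.symm]
    exact hf.form_nonpos_of_isTwoWhite hB hw hg.orthogonal h1 h2
  have right (h1 : (corootValues P σ) y ≤ 0) (h2 : (corootValues P σ) z ≤ 0) : B σ τ ≤ 0 :=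
    hg.form_nonpos_of_isTwoWhite hB hy hf.orthogonal h1 h2
  by_cases hwy : w = y
  · subst hwy
    by_cases hxz : x = z
    · subst hxz
      exact (hf.false_of_isTwoWhite_of_eq hB hg hne hw hy).elim
    · exact hf.form_nonpos_of_isTwoWhite_of_ne hB hSp hg hw hy hxz
  by_cases hwz : w = z
  · subst hwz
    by_cases hxy : x = y
    · subst hxy
      exact (hf.false_of_isTwoWhite_swap hB hSp hg hne hw hy).elim
    -- When the shared vertex comes second in τ, either τ is nonpositive there or the white vertices
    -- of τ can be exchanged. The remaining cases repeat this alternative.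
    · rcases hy' with h | ⟨s', hy'⟩
      · exact left h (hg.apply_coroot_nonpos hxs (g_zero hxy hw.ne.symm hw.notMem₂))
      · exact hf.form_nonpos_of_isTwoWhite_of_ne hB hSp hg hw hy' hxy
  have hτw : (corootValues P τ) w ≤ 0 := hg.apply_coroot_nonpos hws (g_zero hwy hwz hw.notMem₁)
  by_cases hxy : x = y
  · subst hxy
    rcases hw' with h | ⟨r', hw'⟩
    · exact right h (hf.apply_coroot_nonpos hzs (f_zero (Ne.symm hwz) hy.ne.symm hy.notMem₂))
    · exact hf.form_nonpos_of_isTwoWhite_of_ne hB hSp hg hw' hy hwz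
  by_cases hxz : x = z
  · subst hxz
    rcases hw' with h | ⟨r', hw'⟩
    · exact right (hf.apply_coroot_nonpos hys (f_zero (Ne.symm hwy) hy.ne hy.notMem₁)) h
    · rcases hy' with h | ⟨s', hy'⟩
      · exact left hτw h
      · exact hf.form_nonpos_of_isTwoWhite_of_ne hB hSp hg hw' hy' hwy
  · exact left hτw (hg.apply_coroot_nonpos hxs (g_zero hxy hxz hw.notMem₂))

end IsLabelled

/-- Distinct elements of a weak spherical system form an obtuse angle. -/
theorem form_nonpos {P : RootDatum ι Λ Λv} {b : P.Base} {Ξ : AddSubgroup Λ} {Sig : Set Λ}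
    {Sp : Set ι} (hS : IsWeakSphericalSystem P b Ξ Sig Sp) {B : Λ →ₗ[ℤ] Λ →ₗ[ℤ] ℝ}
    (hB : IsInvariantForm P B) {σ τ : Λ} (hσ : σ ∈ Sig) (hτ : τ ∈ Sig) (hne : σ ≠ τ) :
    B σ τ ≤ 0 := by
  obtain ⟨f, hf⟩ := exists_isLabelled hS hσ
  obtain ⟨g, hg⟩ := exists_isLabelled hS hτ
  have hSp := hS.subset_simple
  have pair {σ τ : Λ} (hσ : σ ∈ Sig) (hτ : τ ∈ Sig) (hne : σ ≠ τ) {f g : ι → ℕ}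
      (hf : IsLabelled P b Sp σ f) (hg : IsLabelled P b Sp τ g) {i j : ι}
      (hij : IsOrthogonalPair P.pairing g Sp i j) : B σ τ ≤ 0 := by
    have his : i ∈ b.support := hg.support i (by rw [hij.label₁]; exact one_ne_zero)
    have hjs : j ∈ b.support := hg.support j (by rw [hij.label₂]; exact one_ne_zero)
    have hsum : τ = P.root i + P.root j := by
      rw [hg.eq_sum, Fintype.sum_eq_add i j hij.ne, hij.label₁, hij.label₂, one_smul, one_smul]
      rintro k ⟨h1, h2⟩
      have : g k = 0 := by_contra fun h => (hij.support k h).elim h1 h2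
      rw [this, zero_smul]
    have h := hS.type_D_two i his j hjs hij.pairing (hsum ▸ hτ) σ (hS.subset_lattice hσ)
    rw [map_sub, sub_eq_zero] at h
    exact hf.form_nonpos_of_isOrthogonalPair hB hg hne hij h
  have oneTwo {σ τ : Λ} (hσ : σ ∈ Sig) (hτ : τ ∈ Sig) {f g : ι → ℕ}
      (hf : IsLabelled P b Sp σ f) (hg : IsLabelled P b Sp τ g) {w x y : ι} {r : ℤ}
      (hw : IsOneWhite P.pairing f Sp (corootValues P σ) w)
      (hx : IsTwoWhite P.pairing g Sp (corootValues P τ) x y r)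
      (hxy : (P.toLinearMap τ (P.coroot y)) ≤ 0 ∨ ∃ r',
        IsTwoWhite P.pairing g Sp (corootValues P τ) y x r') : B σ τ ≤ 0 :=
    hf.form_nonpos_of_isOneWhite_of_isTwoWhite hB hSp hg hw hx hxy fun i hi j hj h1 h2 =>
      hS.pairing_ne i hi j hj (h1 ▸ hσ) (h2 ▸ hτ)
  rcases hg.isTabulated with ⟨x, hx⟩ | ⟨x₁, x₂, s, hx, hx'⟩ | ⟨i, j, hij⟩
  · rcases hf.isTabulated with ⟨w, hw⟩ | ⟨w₁, w₂, r, hw, hw'⟩ | ⟨i, j, hij⟩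
    · exact hf.form_nonpos_of_isOneWhite_of_isOneWhite hB hg hne hw hx
    · rw [hB.symm]
      exact oneTwo hτ hσ hg hf hx hw hw'
    · rw [hB.symm]
      exact pair hτ hσ hne.symm hg hf hij
  · rcases hf.isTabulated with ⟨w, hw⟩ | ⟨w₁, w₂, r, hw, hw'⟩ | ⟨i, j, hij⟩
    · exact oneTwo hσ hτ hf hg hw hx hx'
    · exact hf.form_nonpos_of_isTwoWhite_of_isTwoWhite hB hSp hg hne hw hw' hx hx'
    · rw [hB.symm]
      exact pair hτ hσ hne.symm hg hf hij
  · exact pair hσ hτ hne hf hg hij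

/-! ### Invariant forms and coroots -/

variable {ι : Type v} {Λ : Type u} {Λv : Type w} [AddCommGroup Λ] [AddCommGroup Λv]

/-- The canonical form `∑ α^∨ ⊗ α^∨`, with real values. -/
noncomputable def realRootForm [Fintype ι] (P : RootDatum ι Λ Λv) : Λ →ₗ[ℤ] Λ →ₗ[ℤ] ℝ :=
  LinearMap.mk₂ ℤ (fun x y => ((P.RootForm x y : ℤ) : ℝ)) (by simp) (by simp) (by simp) (by simp)

lemma isInvariantForm_realRootForm [Fintype ι] (P : RootDatum ι Λ Λv) :
    IsInvariantForm P (realRootForm P) where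
  symm x y := by
    simp only [realRootForm, LinearMap.mk₂_apply]
    have h : P.RootForm x y = P.RootForm y x := P.rootForm_symmetric.eq x y
    rw [h]
  pos x hx h0 := by
    have h := P.posRootForm_posForm_pos_of_ne_zero ℤ (x := ⟨x, hx⟩)
      fun h => h0 (congrArg Subtype.val h)
    have h' := P.algebraMap_posRootForm_posForm ℤ ⟨x, hx⟩ ⟨x, hx⟩
    simp only [realRootForm, LinearMap.mk₂_apply]
    rw [← h']
    exact_mod_cast h
  two_mul i χ := by
    have h := congrArg (P.toLinearMap χ) (P.rootForm_self_smul_coroot i)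
    rw [map_smul, map_nsmul, P.toLinearMap_apply_apply_Polarization] at h
    simp only [realRootForm, LinearMap.mk₂_apply]
    rw [← P.rootForm_symmetric.eq (P.root i) χ]
    simp only [smul_eq_mul, nsmul_eq_mul] at h
    have h' : (_ : ℝ) = _ := congrArg (Int.cast) h
    push_cast at h'
    simp only [RingHom.id_apply]
    linear_combination -h'

/-- The restriction to `Λ` of a form on `Λ ⊗ ℝ`. -/
noncomputable def restrictForm (B : LinearMap.BilinForm ℝ (ℝ ⊗[ℤ] Λ)) : Λ →ₗ[ℤ] Λ →ₗ[ℤ] ℝ :=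
  LinearMap.mk₂ ℤ (fun x y => B (1 ⊗ₜ[ℤ] x) (1 ⊗ₜ[ℤ] y))
    (by simp [TensorProduct.tmul_add]) (by simp [TensorProduct.tmul_smul])
    (by simp [TensorProduct.tmul_add]) (by simp [TensorProduct.tmul_smul])

lemma restrictForm_apply (B : LinearMap.BilinForm ℝ (ℝ ⊗[ℤ] Λ)) (x y : Λ) :
    restrictForm B x y = B (1 ⊗ₜ[ℤ] x) (1 ⊗ₜ[ℤ] y) := rfl

/-- The perfect pairing supplies y with ⟨x, y⟩ ≠ 0, and pairing with y extends to ℝ ⊗ Λ. -/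
lemma one_tmul_ne_zero (P : RootDatum ι Λ Λv) {x : Λ} (hx : x ≠ 0) : (1 : ℝ) ⊗ₜ[ℤ] x ≠ 0 := by
  intro h
  refine hx ((map_eq_zero_iff P.toLinearMap P.toPerfPair.injective).mp (LinearMap.ext fun y => ?_))
  let φ : ℝ ⊗[ℤ] Λ →ₗ[ℤ] ℝ := TensorProduct.lift
    (LinearMap.mk₂ ℤ (fun (a : ℝ) z => a * ((P.toLinearMap z y : ℤ) : ℝ))
      (by intros; ring) (by intros; simp; ring) (by intros; simp; ring) (by intros; simp; ring))
  have h1 : φ (1 ⊗ₜ[ℤ] x) = 0 := by rw [h, map_zero]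
  have h2 : φ (1 ⊗ₜ[ℤ] x) = 1 * ((P.toLinearMap x y : ℤ) : ℝ) := TensorProduct.lift.tmul _ _
  rw [h1, one_mul] at h2
  exact_mod_cast h2.symm

lemma isInvariantForm_restrictForm {P : RootDatum ι Λ Λv}
    {B : LinearMap.BilinForm ℝ (ℝ ⊗[ℤ] Λ)} (hB : IsWeylInvariantScalarProduct P B) :
    IsInvariantForm P (restrictForm B) where
  symm x y := hB.symm _ _
  pos x _ h0 := hB.pos _ (one_tmul_ne_zero P h0)
  two_mul i χ := by
    have h := hB.invariant i (1 ⊗ₜ χ) (1 ⊗ₜ P.root i)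
    rw [LinearMap.baseChange_tmul, LinearMap.baseChange_tmul] at h
    simp only [LinearEquiv.coe_coe, P.reflection_apply_self, P.reflection_apply] at h
    rw [← restrictForm_apply, ← restrictForm_apply] at h
    simp only [map_sub, map_smul, map_neg, LinearMap.sub_apply, LinearMap.smul_apply, zsmul_eq_mul,
      RootPairing.coroot', LinearMap.flip_apply] at h
    linarith

section

variable [Fintype ι] {P : RootDatum ι Λ Λv} {b : P.Base} {Ξ : AddSubgroup Λ} {Sig : Set Λ}
  {Sp : Set ι}

/-- The coroot is (2/⟨σ, w^∨⟩) w^∨, or r w₁^∨ + w₂^∨, or i^∨ (equal to j^∨ on Ξ). It is chosen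
before the form, which proves independence. -/
theorem exists_coroot (hS : IsWeakSphericalSystem P b Ξ Sig Sp) {σ : Λ} (hσ : σ ∈ Sig) :
    ∃ φ : Module.Dual ℤ Λ, φ σ = 2 ∧ ∀ B, IsInvariantForm P B → ∀ χ ∈ Ξ,
      (φ χ : ℝ) * B σ σ = 2 * B χ σ := by
  obtain ⟨f, hf⟩ := exists_isLabelled hS hσ
  have horth (χ) (hχ : χ ∈ Ξ) : ∀ i ∈ Sp, P.toLinearMap χ (P.coroot i) = 0 :=
    fun i hi => hS.orthogonal i hi χ hχ
  rcases hf.isTabulated with ⟨w, hw⟩ | ⟨w, x, r, hw, -⟩ | ⟨i, j, hij⟩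
  · obtain ⟨c, hc⟩ : ∃ c : ℤ, c * P.toLinearMap σ (P.coroot w) = 2 := by
      rcases hw.val with h | h
      · exact ⟨2, by rw [show P.toLinearMap σ (P.coroot w) = 1 from h, mul_one]⟩
      · exact ⟨1, by rw [show P.toLinearMap σ (P.coroot w) = 2 from h, one_mul]⟩
    refine ⟨c • P.coroot' w, by simpa using hc, fun B hB χ hχ => ?_⟩
    have h1 := hf.two_mul_form_of_isOneWhite hB hw (horth χ hχ)
    have h2 := hf.two_mul_form_of_isOneWhite hB hw hf.orthogonal
    have hc' : (c * P.toLinearMap σ (P.coroot w) : ℝ) = 2 := by exact_mod_cast hc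
    have h3 : ((c • P.coroot' w) χ : ℤ) = c * P.toLinearMap χ (P.coroot w) := by simp
    rw [h3]
    push_cast
    linear_combination (c * P.toLinearMap χ (P.coroot w) / 2 : ℝ) * h2 - h1 +
      (f w * B (P.root w) (P.root w) * P.toLinearMap χ (P.coroot w) / 2 : ℝ) * hc'
  · have v1 : P.toLinearMap σ (P.coroot w) = 1 := hw.val₁
    have v2 : P.toLinearMap σ (P.coroot x) = 2 - r := hw.val₂
    refine ⟨r • P.coroot' w + P.coroot' x, by simp [v1, v2], fun B hB χ hχ => ?_⟩
    have h1 := hf.two_mul_form_of_isTwoWhite hB hw (horth χ hχ)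
    have h2 := hf.two_mul_form_of_isTwoWhite hB hw hf.orthogonal
    rw [v1, v2] at h2
    have h3 : ((r • P.coroot' w + P.coroot' x) χ : ℤ) =
      r * P.toLinearMap χ (P.coroot w) + P.toLinearMap χ (P.coroot x) := by simp
    have h4 := hw.length _ hB.isLength
    rw [h3]
    push_cast at h2 ⊢
    linear_combination
      ((r * P.toLinearMap χ (P.coroot w) + P.toLinearMap χ (P.coroot x)) / 2 : ℝ) * (h2 + h4) - h1 -
      P.toLinearMap χ (P.coroot w) * h4
  · have his : i ∈ b.support := hf.support i (by rw [hij.label₁]; exact one_ne_zero)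
    have hjs : j ∈ b.support := hf.support j (by rw [hij.label₂]; exact one_ne_zero)
    have hsum : σ = P.root i + P.root j := by
      rw [hf.eq_sum, Fintype.sum_eq_add i j hij.ne, hij.label₁, hij.label₂, one_smul, one_smul]
      rintro k ⟨h1, h2⟩
      have : f k = 0 := by_contra fun h => (hij.support k h).elim h1 h2
      rw [this, zero_smul]
    have hD (χ) (hχ : χ ∈ Ξ) : P.toLinearMap χ (P.coroot i) = P.toLinearMap χ (P.coroot j) := by
      have h := hS.type_D_two i his j hjs hij.pairing (hsum ▸ hσ) χ hχ
      rwa [map_sub, sub_eq_zero] at h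
    have hv : P.toLinearMap σ (P.coroot i) = 2 := by
      have hχ := hD σ (hS.subset_lattice hσ)
      rw [hχ, hsum]
      simp [hij.pairing]
    refine ⟨P.coroot' i, hv, fun B hB χ hχ => ?_⟩
    have h1 := hf.two_mul_form_of_isOrthogonalPair hB hij (hD χ hχ)
    have h2 := hf.two_mul_form_of_isOrthogonalPair hB hij (hD σ (hS.subset_lattice hσ))
    rw [hv] at h2
    have h3 : P.coroot' i χ = P.toLinearMap χ (P.coroot i) := rfl
    rw [h3]
    push_cast at h2
    linear_combination (P.toLinearMap χ (P.coroot i) / 2 : ℝ) * h2 - h1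

/-- A vanishing combination of elements of a weak spherical system with nonnegative coefficients is
trivial. -/
lemma eq_zero_of_sum_eq_zero (hS : IsWeakSphericalSystem P b Ξ Sig Sp) {κ : Type*} (e : κ → Λ)
    (he : ∀ k, e k ∈ Sig) (s : Finset κ) (a : κ → ℤ) (ha : ∀ k, 0 ≤ a k)
    (h0 : ∑ k ∈ s, a k • e k = 0) : ∀ k ∈ s, a k = 0 := by
  choose f hf using fun k => exists_isLabelled hS (he k)
  have h1 : ∑ i ∈ b.support, (∑ k ∈ s, a k * f k i) • P.root i = 0 := by
    rw [← h0]
    simp_rw [Finset.sum_smul]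
    rw [Finset.sum_comm]
    refine Finset.sum_congr rfl fun k _ => ?_
    conv_rhs => rw [(hf k).eq_sum]
    rw [Finset.smul_sum, ← Finset.sum_subset (Finset.subset_univ b.support)]
    · simp [mul_smul]
    · intro i _ hi
      have : f k i = 0 := by_contra fun h => hi ((hf k).support i h)
      rw [this, zero_smul, smul_zero]
  intro k hk
  obtain ⟨i, hi⟩ := (hf k).exists_eq_one
  have h2 := linearIndepOn_iff'.mp b.linearIndepOn_root b.support _ subset_rfl h1 i
    ((hf k).support i (by rw [hi]; exact one_ne_zero))
  rw [Finset.sum_eq_zero_iff_of_nonneg fun k _ => mul_nonneg (ha k) (by positivity)] at h2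
  simpa [hi] using h2 k hk

end

end WeakSpherical

/-! ### Conclusion -/

open WeakSpherical

/-- For a weak spherical system `(Ξ, Sig, Sp)`, the coroots `σ^∨`, `σ ∈ Sig`, are elements of
`Ξ^∨` (independent of the invariant scalar product), and `(Ξ, Sig, Ξ^∨, Sig^∨)` is a based root
datum. -/
theorem mainTheorem8 {ι : Type v} [Finite ι] {Λ : Type u} {Λv : Type w}
    [AddCommGroup Λ] [AddCommGroup Λv] [Module.Finite ℤ Λ] [Module.Finite ℤ Λv]
    (P : RootDatum ι Λ Λv) [P.IsReduced] (b : P.Base)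
    (Ξ : AddSubgroup Λ) (Sig : Set Λ) (Sp : Set ι)
    (hS : IsWeakSphericalSystem P b Ξ Sig Sp) :
    ∃ co : Ξ → Module.Dual ℤ Ξ,
      (∀ B : LinearMap.BilinForm ℝ (ℝ ⊗[ℤ] Λ), IsWeylInvariantScalarProduct P B →
        ∀ σ : Ξ, (σ : Λ) ∈ Sig → ∀ χ : Ξ, ((co σ χ : ℤ) : ℝ) = scalarCoroot B (σ : Λ) (χ : Λ)) ∧
      IsBasedRootDatum (Module.Dual.eval ℤ Ξ) {σ : Ξ | (σ : Λ) ∈ Sig} co := by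
  have : Fintype ι := Fintype.ofFinite ι
  let incl : Ξ →ₗ[ℤ] Λ := Ξ.subtype.toIntLinearMap
  have hex (σ : Ξ) : ∃ φ : Module.Dual ℤ Ξ, (σ : Λ) ∈ Sig → φ σ = 2 ∧
      ∀ B, IsInvariantForm P B → ∀ χ : Ξ, (φ χ : ℝ) * B (σ : Λ) σ = 2 * B (χ : Λ) σ := by
    by_cases hσ : (σ : Λ) ∈ Sig
    · obtain ⟨φ, h1, h2⟩ := exists_coroot hS hσ
      exact ⟨φ ∘ₗ incl, fun _ => ⟨h1, fun B hB χ => h2 B hB χ χ.2⟩⟩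
    · exact ⟨0, fun h => absurd h hσ⟩
  choose co hco using hex
  have hspan {σ : Λ} (hσ : σ ∈ Sig) : σ ∈ Submodule.span ℤ (Set.range P.root) := by
    obtain ⟨f, hf⟩ := exists_isLabelled hS hσ
    exact hf.mem_span
  refine ⟨co, fun B hB σ hσ χ => ?_, ?_⟩
  · have hB' := isInvariantForm_restrictForm hB
    obtain ⟨h1, h2⟩ := hco σ hσ
    have hne : (σ : Λ) ≠ 0 := by
      intro h
      rw [show σ = 0 from Subtype.ext h, map_zero] at h1
      norm_num at h1
    exact eq_div_of_mul_eq (hB'.pos _ (hspan hσ) hne).ne' (h2 _ hB' χ)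
  · have : Module.IsReflexive ℤ Λ := .of_isPerfPair P.toLinearMap
    have : Module.IsTorsionFree ℤ Λ := inferInstance
    have : Module.Finite ℤ Ξ := inferInstanceAs (Module.Finite ℤ Ξ.toIntSubmodule)
    have : Module.Free ℤ Ξ := inferInstanceAs (Module.Free ℤ Ξ.toIntSubmodule)
    -- The canonical form may degenerate on Λ, but it is positive on the root lattice, which
    -- contains Σ. No scalar product on all of Λ ⊗ ℝ has to be constructed.
    have hB := isInvariantForm_realRootForm P
    refine isBasedRootDatum_of_obtuse ((realRootForm P).compl₁₂ incl incl)
      (fun x y => hB.symm x y) _ co (fun σ hσ χ => (hco σ hσ).2 _ hB χ) ?_ ?_ ?_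
    · intro x hx h0
      refine hB.pos x ?_ fun h => h0 (Subtype.ext h)
      have : Submodule.span ℤ {σ : Ξ | (σ : Λ) ∈ Sig} ≤
          (Submodule.span ℤ (Set.range P.root)).comap incl :=
        Submodule.span_le.mpr fun σ hσ => hspan hσ
      exact this hx
    · intro σ hσ τ hτ hne
      exact form_nonpos hS hB hσ hτ fun h => hne (Subtype.ext h)
    · intro s a ha h0
      refine eq_zero_of_sum_eq_zero hS (fun i : {σ : Ξ | (σ : Λ) ∈ Sig} => ((i : Ξ) : Λ))
        (fun i => i.2) s a ha ?_
      have := congrArg incl h0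
      simpa [incl] using this
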